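/- Let $M$ be a model of $\mathbf{ZFA}+\mathbf{AC}$ (Zermelo--Fraenkel set theory with a set of atoms, together with the Axiom of Choice), let $A\in M$ be its set of atoms, and let, in $M$, $G$ be a group of permutations of $A$, $\mathscr F$ a normal filter of subgroups of $G$ (a non-empty family of subgroups of $G$ closed under binary intersections, under larger subgroups of $G$ and under conjugation by elements of $G$, and containing the stabilizer in $G$ of each atom), and $\mathscr B$ a filter base of $\mathscr F$ (so $\mathscr B\subseteq\mathscr F$ and every member of $\mathscr F$ includes a member of $\mathscr B$). Extend each $\phi\in G$ to $M$ by $\phi(x)=\{\phi(z):z\in x\}$ for sets $x$. Let $\mathcal N$ be the permutation model determined by $M$, $G$ and $\mathscr F$, i.e. the class of all $x\in M$ such that, for every $y$ which is $x$ or an element of the transitive closure of $x$, $\{\phi\in G:\phi(y)=y\}\in\mathscr F$. A subgroup $B$ of $G$ fixes $x$ if $\phi(x)=x$ for all $\phi\in B$. Suppose that (a) for all $x\in\mathcal N$, $B\in\mathscr B$ and $\phi\in G$: if $B$ fixes $x$, then $B$ fixes $\phi(x)$; (b) for every $x\in\mathcal N$, the orbit $\{\phi(x):\phi\in G\}$ is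 countable in $\mathcal N$. Then both of the following statements are true in $\mathcal N$. (1) For every set $X$, $\mathbf{CAC}(X)$ implies $\mathbf{CAC}(X^{\omega})$. Here $\mathbf{CAC}(Y)$ says that every countable family of non-empty subsets of $Y$ has a choice function, and $X^\omega$ is the set of all functions from $\omega$ to $X$. (2) $\mathbf{PS}_0(\mathbf{II})$: if $X$ is an uncountable set and $\langle A_n\rangle_{n\in\omega}$ is a sequence such that, for every $n\in\omega$, $A_n$ is a non-empty set of non-empty finite subsets of $X$ and the set $C_n$ of all countable $x\subseteq X$ with $x\cap z\neq\emptyset$ for all $z\in A_n$ is non-empty, then there is a function $f$ on $\omega$ with $f(n)\in C_n$ for all $n\in\omega$. A set is countable if it admits an injection into $\omega$ (in the model considered), and uncountable otherwise. -/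

import Mathlib

namespace ZFA

/-- A structure for the language of set theory with atoms: a binary membership relation and a
unary predicate singling out the atoms. -/
class SetStr (M : Type*) where
  /-- `mem x y`: `x` is an element of `y`. -/
  mem : M → M → Prop
  /-- `IsAtom x`: `x` is an atom. -/
  IsAtom : M → Prop

infix:50 " ∈ₘ " => SetStr.mem

/-- The relation symbols of the first-order language of set theory with atoms. -/
inductive Rel : ℕ → Type
  | atom : Rel 1
  | mem : Rel 2

/-- The first-order language of set theory with atoms. -/
def lang : FirstOrder.Language := ⟨fun _ => Empty, Rel⟩

instance (M : Type*) [SetStr M] : lang.Structure M where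
  funMap := fun f _ => f.elim
  RelMap := fun r v =>
    match r, v with
    | Rel.atom, v => SetStr.IsAtom (v 0)
    | Rel.mem, v => v 0 ∈ₘ v 1

section Notions

/-! First-order notions of set theory, read inside a structure: all quantifiers range over the
structure. -/

variable {M : Type*} [SetStr M]

/-- Sets are the objects that are not atoms. -/
def IsSet (x : M) : Prop := ¬ SetStr.IsAtom x

/-- `x` and `y` are sets and `x ⊆ y`. -/
def IsSubset (x y : M) : Prop := IsSet x ∧ IsSet y ∧ ∀ z, z ∈ₘ x → z ∈ₘ y

/-- `x` is the empty set. -/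
def IsEmptySet (x : M) : Prop := IsSet x ∧ ∀ z, ¬ z ∈ₘ x

/-- `x` is a set with at least one element. -/
def IsNonemptySet (x : M) : Prop := IsSet x ∧ ∃ z, z ∈ₘ x

/-- `A` is the set of all atoms. -/
def IsAtomSet (A : M) : Prop := IsSet A ∧ ∀ x, x ∈ₘ A ↔ SetStr.IsAtom x

/-- `p = {x, y}`. -/
def IsUPair (p x y : M) : Prop := IsSet p ∧ ∀ z, z ∈ₘ p ↔ z = x ∨ z = y

/-- `p = ⟨x, y⟩ = {{x}, {x, y}}`. -/
def IsOPair (p x y : M) : Prop := ∃ s d, IsUPair s x x ∧ IsUPair d x y ∧ IsUPair p s d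

/-- `⟨x, y⟩ ∈ f`; when `f` is a function, this says `f(x) = y`. -/
def Maps (f x y : M) : Prop := ∃ p, p ∈ₘ f ∧ IsOPair p x y

/-- `f` is a function with domain `X`. -/
def IsFunOn (f X : M) : Prop :=
  IsSet f ∧ IsSet X ∧ (∀ p, p ∈ₘ f → ∃ x, x ∈ₘ X ∧ ∃ y, IsOPair p x y) ∧
    ∀ x, x ∈ₘ X → ∃! y, Maps f x y

/-- `f` is a function from the set `X` to the set `Y`. -/
def IsFun (f X Y : M) : Prop := IsFunOn f X ∧ IsSet Y ∧ ∀ x y, Maps f x y → y ∈ₘ Y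

/-- `f` is an injection from `X` to `Y`. -/
def IsInj (f X Y : M) : Prop :=
  IsFun f X Y ∧ ∀ x x' y, Maps f x y → Maps f x' y → x = x'

/-- `f` is a bijection from `X` onto `Y`. -/
def IsBij (f X Y : M) : Prop := IsInj f X Y ∧ ∀ y, y ∈ₘ Y → ∃ x, Maps f x y

/-- `s = n ∪ {n}`. -/
def IsSucc (s n : M) : Prop := IsSet s ∧ ∀ z, z ∈ₘ s ↔ z ∈ₘ n ∨ z = n

/-- `w` is an inductive set: it contains `∅` and is closed under `n ↦ n ∪ {n}`. -/
def IsInductive (w : M) : Prop :=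
  IsSet w ∧ (∃ e, IsEmptySet e ∧ e ∈ₘ w) ∧ ∀ n, n ∈ₘ w → ∃ s, IsSucc s n ∧ s ∈ₘ w

/-- `w = ω`, the least inductive set. -/
def IsOmega (w : M) : Prop := IsInductive w ∧ ∀ v, IsInductive v → IsSubset w v

/-- `x` is a countable set: it injects into `ω`. -/
def IsCountableSet (x : M) : Prop := ∃ w, IsOmega w ∧ ∃ f, IsInj f x w

/-- `x` is a finite set: it is equipotent to an element of `ω`. -/
def IsFiniteSet (x : M) : Prop := ∃ w, IsOmega w ∧ ∃ n, n ∈ₘ w ∧ ∃ f, IsBij f x n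

/-- `t` is a transitive set. -/
def IsTransitiveSet (t : M) : Prop := IsSet t ∧ ∀ y, y ∈ₘ t → ∀ z, z ∈ₘ y → z ∈ₘ t

/-- `f` is a choice function on the family `R`. -/
def IsChoiceFun (f R : M) : Prop := IsFunOn f R ∧ ∀ a y, Maps f a y → y ∈ₘ a

/-- `P = X ^ w`, the set of all functions from `w` to `X`. -/
def IsFunSpace (P X w : M) : Prop := IsSet P ∧ ∀ f, f ∈ₘ P ↔ IsFun f w X

/-- `CAC(X)`: every countable family of non-empty subsets of `X` has a choice function. -/
def CAC (X : M) : Prop :=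
  ∀ R : M, IsCountableSet R → (∀ a, a ∈ₘ R → IsSubset a X ∧ IsNonemptySet a) →
    ∃ f, IsChoiceFun f R

/-- `CAC(X ^ ω)`. -/
def CACPowOmega (X : M) : Prop := ∃ w P, IsOmega w ∧ IsFunSpace P X w ∧ CAC P

/-- `a` is a non-empty family of non-empty finite subsets of `X`. -/
def IsFinFamily (a X : M) : Prop :=
  IsNonemptySet a ∧ ∀ z, z ∈ₘ a → IsSubset z X ∧ IsFiniteSet z ∧ IsNonemptySet z

/-- `x` is a countable subset of `X` that meets every member of `a`. -/
def IsCountableHitting (x a X : M) : Prop :=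
  IsSubset x X ∧ IsCountableSet x ∧ ∀ z, z ∈ₘ a → ∃ u, u ∈ₘ x ∧ u ∈ₘ z

end Notions

/-- `(∀ X) (CAC(X) → CAC(X ^ ω))`, read in the structure `M`. -/
def CACTransfer (M : Type*) [SetStr M] : Prop :=
  ∀ X : M, IsSet X → CAC X → CACPowOmega X

/-- The principle `PS₀(II)`, read in the structure `M`: if `X` is an uncountable set and
`S = ⟨Sₙ : n ∈ ω⟩` is a sequence of non-empty families of non-empty finite subsets of `X` such
that each `Cₙ = {x ⊆ X : x countable, x meets every member of Sₙ}` is non-empty, then there is a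
function `f` on `ω` with `f(n) ∈ Cₙ` for all `n`. -/
def PSZeroII (M : Type*) [SetStr M] : Prop :=
  ∀ X w S : M, IsSet X → ¬ IsCountableSet X → IsOmega w → IsFunOn S w →
    (∀ n a, Maps S n a → IsFinFamily a X) →
    (∀ n a, Maps S n a → ∃ x, IsCountableHitting x a X) →
    ∃ f, IsFunOn f w ∧ ∀ n a x, Maps S n a → Maps f n x → IsCountableHitting x a X

/-- `M` is a model of `ZFA + AC`. The Separation and Replacement schemas range over the classes
and class relations that are first-order definable over `M` with parameters. -/
structure IsModelZFAC (M : Type*) [SetStr M] : Prop where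
  atom_no_mem : ∀ a x : M, SetStr.IsAtom a → ¬ x ∈ₘ a
  atom_set : ∃ A : M, IsAtomSet A
  extensionality : ∀ x y : M, IsSet x → IsSet y → (∀ z, z ∈ₘ x ↔ z ∈ₘ y) → x = y
  empty_set : ∃ e : M, IsEmptySet e
  pairing : ∀ x y : M, ∃ p, IsUPair p x y
  union : ∀ x : M, ∃ u, IsSet u ∧ ∀ z, z ∈ₘ u ↔ ∃ y, y ∈ₘ x ∧ z ∈ₘ y
  powerset : ∀ x : M, IsSet x → ∃ p, IsSet p ∧ ∀ z, z ∈ₘ p ↔ IsSubset z x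
  infinity : ∃ w : M, IsInductive w
  foundation : ∀ x : M, (∃ y, y ∈ₘ x) → ∃ y, y ∈ₘ x ∧ ∀ z, z ∈ₘ y → ¬ z ∈ₘ x
  separation : ∀ S : Set M, (Set.univ : Set M).Definable₁ lang S →
    ∀ x : M, ∃ y, IsSet y ∧ ∀ z, z ∈ₘ y ↔ z ∈ₘ x ∧ z ∈ S
  replacement : ∀ R : Set (M × M), (Set.univ : Set M).Definable₂ lang R →
    ∀ x : M, (∀ u v v', u ∈ₘ x → (u, v) ∈ R → (u, v') ∈ R → v = v') →
      ∃ y, IsSet y ∧ ∀ v, v ∈ₘ y ↔ ∃ u, u ∈ₘ x ∧ (u, v) ∈ R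
  choice : ∀ R : M, IsSet R → (∀ a, a ∈ₘ R → IsNonemptySet a) → ∃ f, IsChoiceFun f R

section PermutationModel

variable {M : Type*} [SetStr M]

/-- `G` is (a set of `M` that is) a group of permutations of `A` under composition. -/
def IsPermGroup (G A : M) : Prop :=
  IsSet G ∧ (∀ φ, φ ∈ₘ G → IsBij φ A A) ∧
    (∃ i, i ∈ₘ G ∧ ∀ x, x ∈ₘ A → Maps i x x) ∧
    (∀ φ ψ, φ ∈ₘ G → ψ ∈ₘ G →
      ∃ χ, χ ∈ₘ G ∧ ∀ x y z, Maps ψ x y → Maps φ y z → Maps χ x z) ∧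
    ∀ φ, φ ∈ₘ G → ∃ ψ, ψ ∈ₘ G ∧ ∀ x y, Maps φ x y → Maps ψ y x

/-- `H` is a subgroup of the group `G` of permutations of `A`. -/
def IsSubgroupOf (H G A : M) : Prop := IsSubset H G ∧ IsPermGroup H A

/-- `χ = φ ∘ ψ ∘ φ⁻¹`, for permutations `φ`, `ψ`, `χ` of the same set. -/
def IsConjugate (χ φ ψ : M) : Prop :=
  ∀ x y x' y', Maps φ x x' → Maps φ y y' → Maps ψ x y → Maps χ x' y'

/-- `F` is a normal filter (of subgroups) on the group `G` of permutations of the set `A`. -/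
structure IsNormalFilter (F G A : M) : Prop where
  isSet : IsSet F
  subgroup : ∀ H, H ∈ₘ F → IsSubgroupOf H G A
  top_mem : G ∈ₘ F
  upward : ∀ H K, H ∈ₘ F → IsSubgroupOf K G A → IsSubset H K → K ∈ₘ F
  inter : ∀ H K, H ∈ₘ F → K ∈ₘ F → ∃ L, L ∈ₘ F ∧ ∀ φ, φ ∈ₘ L ↔ φ ∈ₘ H ∧ φ ∈ₘ K
  conj : ∀ φ H, φ ∈ₘ G → H ∈ₘ F →
    ∃ K, K ∈ₘ F ∧ ∀ χ, χ ∈ₘ K ↔ χ ∈ₘ G ∧ ∃ ψ, ψ ∈ₘ H ∧ IsConjugate χ φ ψ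
  stabilizer : ∀ a, a ∈ₘ A → ∃ H, H ∈ₘ F ∧ ∀ φ, φ ∈ₘ H ↔ φ ∈ₘ G ∧ Maps φ a a

/-- `B` is a base of the filter `F`. -/
def IsFilterBase (B F : M) : Prop :=
  IsSet B ∧ (∀ H, H ∈ₘ B → H ∈ₘ F) ∧ ∀ K, K ∈ₘ F → ∃ H, H ∈ₘ B ∧ IsSubset H K

/-- `φ(x) = y`, where the permutation `φ` of the atoms is extended to all of `M` by the recursion
`φ(x) = {φ(z) : z ∈ x}` for sets `x`: some function `f` on a transitive set `t ∋ x` obeys this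
recursion, agrees with `φ` on the atoms in `t`, and has `f(x) = y`. -/
def ActsTo (φ x y : M) : Prop :=
  ∃ t f, IsTransitiveSet t ∧ IsFunOn f t ∧
    (∀ a b, SetStr.IsAtom a → Maps f a b → Maps φ a b) ∧
    (∀ u v, IsSet u → Maps f u v →
      IsSet v ∧ ∀ z', z' ∈ₘ v ↔ ∃ z, z ∈ₘ u ∧ Maps f z z') ∧
    Maps f x y

/-- `H` fixes `x`: `φ(x) = x` for all `φ ∈ H`. -/
def Fixes (H x : M) : Prop := ∀ φ, φ ∈ₘ H → ActsTo φ x x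

/-- `x` is symmetric: its stabilizer `{φ ∈ G : φ(x) = x}` belongs to `F`. -/
def IsSymmetric (G F x : M) : Prop :=
  ∃ H, H ∈ₘ F ∧ ∀ φ, φ ∈ₘ H ↔ φ ∈ₘ G ∧ ActsTo φ x x

/-- `x` is hereditarily symmetric: `x` and all elements of its transitive closure are symmetric,
that is, `x` lies in a transitive set all of whose elements are symmetric. -/
def IsHereditarilySymmetric (G F x : M) : Prop :=
  ∃ t, IsTransitiveSet t ∧ x ∈ₘ t ∧ ∀ y, y ∈ₘ t → IsSymmetric G F y

/-- The permutation model determined by `M`, `G` and `F`: the hereditarily symmetric objects. -/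
def PermModel (G F : M) : Type _ := {x : M // IsHereditarilySymmetric G F x}

/-- Membership and atoms of the permutation model are those of `M`. -/
instance (G F : M) : SetStr (PermModel G F) where
  mem := fun x y => x.1 ∈ₘ y.1
  IsAtom := fun x => SetStr.IsAtom x.1

/-- `O = {φ(x) : φ ∈ G}`. -/
def IsOrbit (O G x : M) : Prop := IsSet O ∧ ∀ y, y ∈ₘ O ↔ ∃ φ, φ ∈ₘ G ∧ ActsTo φ x y

end PermutationModel

end ZFA

open ZFA

/-!
The idea of both parts is to replace data chosen in `M`, which need not be symmetric, by the union
of its orbits under the whole group `G`. Such unions, cut down to a set `X` of the permutation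
model `N`, are fixed by the stabilizer of `X`, whatever was chosen
(`PermSystem.fixes_saturation`). So sequences of them lie in `N`. Condition (a) goes the other way:
a group of the base that fixes one element of an orbit fixes all elements of the orbit.

For `PS₀(II)`, choose in `M` a countable hitting set `cₙ` for each `n`, and let `dₙ ⊇ cₙ` be the set
of all `φ(u) ∈ X` with `u ∈ cₙ` and `φ ∈ G`. The sequence `⟨dₙ⟩` is fixed by the stabilizer of `X`.
By (b), `dₙ` is a countable union of countable sets, hence countable in `M`; and a group of the base
that fixes an enumeration of `cₙ` fixes each element of `cₙ`, hence by (a) each element of `dₙ`,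
hence each enumeration of `dₙ` that `M` has (`PermSystem.isCountableSet_permModel_of_fixes`).

For the transfer of `CAC`, take in `M` a choice function `c` for the given countable family of
non-empty subsets of `X ^ ω`. The traces on `X` of the orbits of the points `c(r)(n)` form a family
that is countable in `N`, so `CAC(X)` picks in `N` one point from each trace. A group of the base
that fixes this selection and `X` fixes the selected points, hence by (a) all points `c(r)(n)`,
hence all `c(r)`. Intersected with a group that fixes an enumeration of the family, it fixes `c`.

The set theory that this needs is developed inside `M`, whose Separation and Replacement schemas
cover definable classes only. Definability is a type class (`DefPred`, `DefFun`), so that instance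
resolution proves it from the shape of a predicate. Recursion on `ω` (`exists_rec`) puts each
object into a transitive set, hence `∈`-induction (`mem_induction`), and an enumeration of `ω × ω`
(`exists_enum_pairs`), hence that countable unions of countable sets are countable
(`isCountableSet_iUnion`). By `∈`-induction each permutation of the atoms acts on `M`
(`IsAtomPerm.exists_actsTo`), and a definable such action is determined by its values at the atoms
(`IsHom.ext`).
-/

namespace ZFA

/-! ### Definable predicates and functions -/

section Definability

variable {M : Type*} [SetStr M]

/-- `P` is first-order definable with parameters. A class, so that instance resolution can prove
definability by recursion on the shape of `P`. -/
class DefPred {n : ℕ} (P : (Fin n → M) → Prop) : Prop where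
  definable : (Set.univ : Set M).Definable lang {v | P v}

/-- `f` has a graph that is first-order definable with parameters. -/
class DefFun {n : ℕ} (f : (Fin n → M) → M) : Prop where
  definable : (Set.univ : Set M).DefinableFun lang f

variable {n k : ℕ}

instance DefFun.var (i : Fin n) : DefFun (fun v : Fin n → M => v i) :=
  ⟨Set.DefinableFun.proj lang⟩

instance DefFun.const (c : M) : DefFun (fun _ : Fin n → M => c) :=
  ⟨FirstOrder.Language.definableFun_const lang (A := Set.univ) _ (Set.mem_univ c)⟩

/-- Definability is preserved by substituting definable functions for the variables. -/
theorem DefPred.subst {P : (Fin k → M) → Prop} (hP : DefPred P) (g : Fin k → (Fin n → M) → M)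
    (hg : ∀ i, DefFun (g i)) : DefPred fun v => P fun i => g i v :=
  ⟨Set.Definable.preimage_map (F := fun v i => g i v) (fun i => (hg i).definable) hP.definable⟩

theorem DefFun.subst {f : (Fin k → M) → M} (hf : DefFun f) (g : Fin k → (Fin n → M) → M)
    (hg : ∀ i, DefFun (g i)) : DefFun fun v => f fun i => g i v :=
  ⟨Set.DefinableFun.comp (g := fun v i => g i v) (fun i => (hg i).definable) hf.definable⟩

instance DefFun.reindex {f : (Fin k → M) → M} [hf : DefFun f] (σ : Fin k → Fin n) :
    DefFun fun v : Fin n → M => f fun i => v (σ i) :=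
  hf.subst (fun i v => v (σ i)) fun _ => inferInstance

theorem DefPred.subst₁ {P : M → Prop} (hP : DefPred fun v : Fin 1 → M => P (v 0))
    {f : (Fin n → M) → M} [hf : DefFun f] : DefPred fun v => P (f v) :=
  hP.subst (fun _ => f) fun _ => hf

theorem DefPred.subst₂ {P : M → M → Prop} (hP : DefPred fun v : Fin 2 → M => P (v 0) (v 1))
    {f g : (Fin n → M) → M} [hf : DefFun f] [hg : DefFun g] : DefPred fun v => P (f v) (g v) :=
  hP.subst ![f, g] fun i => by fin_cases i <;> assumption

theorem DefPred.congr {P Q : (Fin n → M) → Prop} (hP : DefPred P) (h : ∀ v, P v ↔ Q v) :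
    DefPred Q := by
  have : P = Q := funext fun v => propext (h v)
  exact this ▸ hP

instance DefPred.eq {f g : (Fin n → M) → M} [hf : DefFun f] [hg : DefFun g] :
    DefPred fun v => f v = g v :=
  ⟨hf.definable.ofPred_eq hg.definable⟩

theorem DefPred.rel₁ (R : lang.Relations 1) :
    DefPred fun v : Fin 1 → M => FirstOrder.Language.Structure.RelMap R ![v 0] := by
  refine ⟨Set.Definable.mono (A := ∅) ?_ (Set.empty_subset _)⟩
  rw [Set.empty_definable_iff]
  refine ⟨R.formula₁ (.var 0), ?_⟩
  ext v
  simp only [Set.mem_ofPred_eq, FirstOrder.Language.Formula.realize_rel₁]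
  rfl

theorem DefPred.rel₂ (R : lang.Relations 2) :
    DefPred fun v : Fin 2 → M => FirstOrder.Language.Structure.RelMap R ![v 0, v 1] := by
  refine ⟨Set.Definable.mono (A := ∅) ?_ (Set.empty_subset _)⟩
  rw [Set.empty_definable_iff]
  refine ⟨R.formula₂ (.var 0) (.var 1), ?_⟩
  ext v
  simp only [Set.mem_ofPred_eq, FirstOrder.Language.Formula.realize_rel₂]
  rfl

instance DefPred.mem {f g : (Fin n → M) → M} [DefFun f] [DefFun g] :
    DefPred fun v => f v ∈ₘ g v :=
  DefPred.subst₂ (P := SetStr.mem) (DefPred.rel₂ Rel.mem)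

instance DefPred.isAtom {f : (Fin n → M) → M} [DefFun f] :
    DefPred fun v => SetStr.IsAtom (f v) :=
  DefPred.subst₁ (P := SetStr.IsAtom) (DefPred.rel₁ Rel.atom)

instance DefPred.and {P Q : (Fin n → M) → Prop} [hP : DefPred P] [hQ : DefPred Q] :
    DefPred fun v => P v ∧ Q v :=
  ⟨hP.definable.inter hQ.definable⟩

instance DefPred.or {P Q : (Fin n → M) → Prop} [hP : DefPred P] [hQ : DefPred Q] :
    DefPred fun v => P v ∨ Q v :=
  ⟨hP.definable.union hQ.definable⟩

instance DefPred.not {P : (Fin n → M) → Prop} [hP : DefPred P] : DefPred fun v => ¬ P v :=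
  ⟨hP.definable.compl⟩

instance DefPred.imp {P Q : (Fin n → M) → Prop} [hP : DefPred P] [hQ : DefPred Q] :
    DefPred fun v => P v → Q v :=
  DefPred.congr (P := fun v => ¬ P v ∨ Q v) inferInstance fun _ => imp_iff_not_or.symm

instance DefPred.iff {P Q : (Fin n → M) → Prop} [hP : DefPred P] [hQ : DefPred Q] :
    DefPred fun v => P v ↔ Q v :=
  DefPred.congr (P := fun v => (P v → Q v) ∧ (Q v → P v)) inferInstance fun _ => iff_def.symm

/-- The quantified variable becomes the variable `0`, and the other variables are shifted. -/
instance DefPred.ex {P : (Fin n → M) → M → Prop}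
    [hP : DefPred fun w : Fin (n + 1) → M => P (fun i => w i.succ) (w 0)] :
    DefPred fun v => ∃ y, P v y := by
  refine ⟨?_⟩
  convert hP.definable.image_comp Fin.succ using 1
  ext v
  constructor
  · rintro ⟨y, hy⟩
    exact ⟨Fin.cons y v, hy, rfl⟩
  · rintro ⟨w, hw, rfl⟩
    exact ⟨w 0, hw⟩

instance DefPred.all {P : (Fin n → M) → M → Prop}
    [hP : DefPred fun w : Fin (n + 1) → M => P (fun i => w i.succ) (w 0)] :
    DefPred fun v => ∀ y, P v y :=
  DefPred.congr (P := fun v => ¬ ∃ y, ¬ P v y) inferInstance fun _ => by simp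

instance DefPred.existsUnique {P : (Fin n → M) → M → Prop}
    [hP : DefPred fun w : Fin (n + 1) → M => P (fun i => w i.succ) (w 0)]
    [hP' : DefPred fun w : Fin (n + 2) → M => P (fun i => w i.succ.succ) (w 0)] :
    DefPred fun v => ∃! y, P v y := by
  unfold ExistsUnique
  infer_instance

theorem DefFun.of_graph {f : (Fin n → M) → M}
    (h : DefPred fun w : Fin (n + 1) → M => w 0 = f fun i => w i.succ) : DefFun f := by
  refine ⟨?_⟩
  have := h.definable.preimage_comp (β := Option (Fin n)) (Fin.cons none some)
  rw [Set.DefinableFun]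
  convert this using 1
  ext w
  exact eq_comm

variable {f g h : (Fin n → M) → M} [DefFun f] [DefFun g] [DefFun h]

instance : DefPred fun v => IsSet (f v) := by unfold IsSet; infer_instance
instance : DefPred fun v => IsSubset (f v) (g v) := by unfold IsSubset; infer_instance
instance : DefPred fun v => IsEmptySet (f v) := by unfold IsEmptySet; infer_instance
instance : DefPred fun v => IsUPair (f v) (g v) (h v) := by unfold IsUPair; infer_instance
instance : DefPred fun v => IsOPair (f v) (g v) (h v) := by unfold IsOPair; infer_instance
instance : DefPred fun v => Maps (f v) (g v) (h v) := by unfold Maps; infer_instance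
instance : DefPred fun v => IsFunOn (f v) (g v) := by unfold IsFunOn; infer_instance
instance : DefPred fun v => IsFun (f v) (g v) (h v) := by unfold IsFun; infer_instance
instance : DefPred fun v => IsInj (f v) (g v) (h v) := by unfold IsInj; infer_instance
instance : DefPred fun v => IsSucc (f v) (g v) := by unfold IsSucc; infer_instance
instance : DefPred fun v => IsInductive (f v) := by unfold IsInductive; infer_instance
instance : DefPred fun v => IsTransitiveSet (f v) := by unfold IsTransitiveSet; infer_instance
instance : DefPred fun v => ActsTo (f v) (g v) (h v) := by unfold ActsTo; infer_instance
instance : DefPred fun v => Fixes (f v) (g v) := by unfold Fixes; infer_instance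
instance : DefPred fun v => IsSymmetric (f v) (g v) (h v) := by unfold IsSymmetric; infer_instance
instance : DefPred fun v => IsHereditarilySymmetric (f v) (g v) (h v) := by
  unfold IsHereditarilySymmetric; infer_instance

end Definability

/-! ### Set theory inside a model -/

section Basic

variable {M : Type*} [SetStr M]

/-- Definability of a predicate on `M`. -/
abbrev Def₁ (P : M → Prop) : Prop := DefPred fun v : Fin 1 → M => P (v 0)

/-- Definability of a binary relation on `M`. -/
abbrev Def₂ (R : M → M → Prop) : Prop := DefPred fun v : Fin 2 → M => R (v 0) (v 1)

/-- Definability of a function from `M` to `M`. -/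
abbrev DefFun₁ (F : M → M) : Prop := DefFun fun v : Fin 1 → M => F (v 0)

theorem DefFun.subst₁ {F : M → M} (hF : DefFun₁ F) {n : ℕ} {f : (Fin n → M) → M} [hf : DefFun f] :
    DefFun fun v => F (f v) :=
  DefFun.subst hF (fun _ => f) fun _ => hf

theorem IsFunOn.exists_maps {f X x : M} (hf : IsFunOn f X) (h : x ∈ₘ X) : ∃ y, Maps f x y :=
  (hf.2.2.2 x h).exists

variable [hM : Fact (IsModelZFAC M)]

theorem set_ext {x y : M} (hx : IsSet x) (hy : IsSet y) (h : ∀ z, z ∈ₘ x ↔ z ∈ₘ y) : x = y :=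
  hM.out.extensionality x y hx hy h

theorem isSet_of_mem {x z : M} (h : z ∈ₘ x) : IsSet x := fun ha => hM.out.atom_no_mem x z ha h

theorem exists_sep (x : M) (P : M → Prop) [hP : Def₁ P] :
    ∃ y, IsSet y ∧ ∀ z, z ∈ₘ y ↔ z ∈ₘ x ∧ P z :=
  hM.out.separation {z | P z} hP.definable x

theorem exists_replacement (x : M) (R : M → M → Prop) [hR : Def₂ R]
    (h : ∀ u, u ∈ₘ x → ∀ v v', R u v → R u v' → v = v') :
    ∃ y, IsSet y ∧ ∀ v, v ∈ₘ y ↔ ∃ u, u ∈ₘ x ∧ R u v :=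
  hM.out.replacement {p | R p.1 p.2} hR.definable x fun u v v' hu => h u hu v v'

theorem exists_image (x : M) (F : M → M) [hF : DefFun₁ F] :
    ∃ y, IsSet y ∧ ∀ v, v ∈ₘ y ↔ ∃ u, u ∈ₘ x ∧ v = F u := by
  have := @hF.subst₁
  exact exists_replacement x (fun u v => v = F u) fun u _ v v' h h' => h.trans h'.symm

/-- `{x, y}`. -/
noncomputable def upair (x y : M) : M := (hM.out.pairing x y).choose

theorem isSet_upair (x y : M) : IsSet (upair x y) := (hM.out.pairing x y).choose_spec.1

@[simp] theorem mem_upair {x y z : M} : z ∈ₘ upair x y ↔ z = x ∨ z = y :=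
  (hM.out.pairing x y).choose_spec.2 z

theorem isUPair_iff {p x y : M} : IsUPair p x y ↔ p = upair x y := by
  constructor
  · rintro ⟨h1, h2⟩
    exact set_ext h1 (isSet_upair x y) fun z => by simp [h2]
  · rintro rfl
    exact ⟨isSet_upair x y, fun z => mem_upair⟩

instance {n : ℕ} {f g : (Fin n → M) → M} [DefFun f] [DefFun g] :
    DefFun fun v => upair (f v) (g v) :=
  DefFun.of_graph <| DefPred.congr (P := fun w : Fin (n + 1) → M =>
    IsUPair (w 0) (f fun i => w i.succ) (g fun i => w i.succ)) inferInstance fun _ => isUPair_iff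

theorem upair_eq_singleton {x y z : M} : upair x y = upair z z ↔ x = z ∧ y = z := by
  constructor
  · intro h
    have h1 : x ∈ₘ upair z z := h ▸ mem_upair.2 (Or.inl rfl)
    have h2 : y ∈ₘ upair z z := h ▸ mem_upair.2 (Or.inr rfl)
    simpa using And.intro h1 h2
  · rintro ⟨rfl, rfl⟩; rfl

/-- `⟨x, y⟩`. -/
noncomputable def opair (x y : M) : M := upair (upair x x) (upair x y)

theorem isOPair_iff {p x y : M} : IsOPair p x y ↔ p = opair x y := by
  simp [IsOPair, isUPair_iff, opair]

instance {n : ℕ} {f g : (Fin n → M) → M} [DefFun f] [DefFun g] :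
    DefFun fun v => opair (f v) (g v) := by
  unfold opair; infer_instance

theorem opair_inj {x y x' y' : M} : opair x y = opair x' y' ↔ x = x' ∧ y = y' := by
  constructor
  · intro h
    have h1 : upair x x ∈ₘ opair x' y' := h ▸ mem_upair.2 (Or.inl rfl)
    have hx : x = x' := by
      rcases mem_upair.1 h1 with h1 | h1
      · exact (upair_eq_singleton.1 h1).1
      · exact ((upair_eq_singleton.1 h1.symm).1).symm
    subst hx
    have h2 : upair x y ∈ₘ opair x y' := h ▸ mem_upair.2 (Or.inr rfl)
    have h3 : upair x y' ∈ₘ opair x y := h ▸ mem_upair.2 (Or.inr rfl)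
    refine ⟨rfl, ?_⟩
    rcases mem_upair.1 h2 with h2 | h2
    · have := (upair_eq_singleton.1 h2).2
      subst this
      rcases mem_upair.1 h3 with h3 | h3 <;> exact ((upair_eq_singleton.1 h3).2).symm
    · have h4 : y ∈ₘ upair x y' := h2 ▸ mem_upair.2 (Or.inr rfl)
      have h5 : y' ∈ₘ upair x y := h2 ▸ mem_upair.2 (Or.inr rfl)
      rcases mem_upair.1 h4 with h4 | h4
      · subst h4
        rcases mem_upair.1 h5 with h5 | h5 <;> exact h5.symm
      · exact h4
  · rintro ⟨rfl, rfl⟩; rfl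

theorem maps_iff {f x y : M} : Maps f x y ↔ opair x y ∈ₘ f := by
  simp [Maps, isOPair_iff]

theorem exists_insert (x y : M) : ∃ u, IsSet u ∧ ∀ z, z ∈ₘ u ↔ z ∈ₘ x ∨ z = y := by
  obtain ⟨u, hu, h⟩ := hM.out.union (upair x (upair y y))
  exact ⟨u, hu, fun z => by simp [h, or_and_right, exists_or]⟩

/-- `x ∪ {y}`. -/
noncomputable def ins (x y : M) : M := (exists_insert x y).choose

theorem isSet_ins (x y : M) : IsSet (ins x y) := (exists_insert x y).choose_spec.1

@[simp] theorem mem_ins {x y z : M} : z ∈ₘ ins x y ↔ z ∈ₘ x ∨ z = y :=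
  (exists_insert x y).choose_spec.2 z

theorem eq_ins_iff {x y u : M} : u = ins x y ↔ IsSet u ∧ ∀ z, z ∈ₘ u ↔ z ∈ₘ x ∨ z = y := by
  constructor
  · rintro rfl
    exact ⟨isSet_ins x y, fun z => mem_ins⟩
  · rintro ⟨h1, h2⟩
    exact set_ext h1 (isSet_ins x y) fun z => by simp [h2]

instance {n : ℕ} {f g : (Fin n → M) → M} [DefFun f] [DefFun g] :
    DefFun fun v => ins (f v) (g v) :=
  DefFun.of_graph <| DefPred.congr (P := fun w : Fin (n + 1) → M =>
    IsSet (w 0) ∧ ∀ z, z ∈ₘ w 0 ↔ z ∈ₘ f (fun i => w i.succ) ∨ z = g fun i => w i.succ)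
    inferInstance fun _ => eq_ins_iff.symm

/-- `⋃ x`. -/
noncomputable def sUnion (x : M) : M := (hM.out.union x).choose

theorem isSet_sUnion (x : M) : IsSet (sUnion x) := (hM.out.union x).choose_spec.1

@[simp] theorem mem_sUnion {x z : M} : z ∈ₘ sUnion x ↔ ∃ y, y ∈ₘ x ∧ z ∈ₘ y :=
  (hM.out.union x).choose_spec.2 z

instance {n : ℕ} {f : (Fin n → M) → M} [DefFun f] : DefFun fun v => sUnion (f v) :=
  DefFun.of_graph <| DefPred.congr (P := fun w : Fin (n + 1) → M =>
    IsSet (w 0) ∧ ∀ z, z ∈ₘ w 0 ↔ ∃ y, y ∈ₘ f (fun i => w i.succ) ∧ z ∈ₘ y)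
    inferInstance fun w => by
      constructor
      · rintro ⟨h1, h2⟩
        exact set_ext h1 (isSet_sUnion _) fun z => by simp [h2]
      · intro h
        rw [h]
        exact ⟨isSet_sUnion _, fun z => mem_sUnion⟩

theorem exists_prod (X Y : M) :
    ∃ Z, IsSet Z ∧ ∀ p, p ∈ₘ Z ↔ ∃ x y, x ∈ₘ X ∧ y ∈ₘ Y ∧ p = opair x y := by
  obtain ⟨W, -, hW⟩ := exists_replacement X
    (fun x u => IsSet u ∧ ∀ p, p ∈ₘ u ↔ ∃ y, y ∈ₘ Y ∧ p = opair x y)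
    fun x _ u u' h h' => set_ext h.1 h'.1 fun z => by rw [h.2, h'.2]
  refine ⟨sUnion W, isSet_sUnion W, fun p => ?_⟩
  rw [mem_sUnion]
  constructor
  · rintro ⟨u, hu, hp⟩
    obtain ⟨x, hx, hs, h⟩ := (hW u).1 hu
    obtain ⟨y, hy, rfl⟩ := (h p).1 hp
    exact ⟨x, y, hx, hy, rfl⟩
  · rintro ⟨x, y, hx, hy, rfl⟩
    obtain ⟨u, hu, h⟩ := exists_image Y (fun y => opair x y)
    exact ⟨u, (hW u).2 ⟨x, hx, hu, h⟩, (h _).2 ⟨y, hy, rfl⟩⟩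

/-! ### Functions -/

theorem IsFunOn.mem_dom {f X x y : M} (hf : IsFunOn f X) (h : Maps f x y) : x ∈ₘ X := by
  obtain ⟨x', hx', y', h'⟩ := hf.2.2.1 _ (maps_iff.1 h)
  rw [isOPair_iff, opair_inj] at h'
  exact h'.1 ▸ hx'

theorem IsFunOn.eq_of_maps {f X x y y' : M} (hf : IsFunOn f X) (h : Maps f x y)
    (h' : Maps f x y') : y = y' :=
  (hf.2.2.2 x (hf.mem_dom h)).unique h h'

theorem IsFunOn.eq_opair {f X p : M} (hf : IsFunOn f X) (h : p ∈ₘ f) :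
    ∃ x y, p = opair x y ∧ Maps f x y := by
  obtain ⟨x, hx, y, h'⟩ := hf.2.2.1 _ h
  rw [isOPair_iff] at h'
  exact ⟨x, y, h', maps_iff.2 (h' ▸ h)⟩

theorem exists_fun (X : M) (hX : IsSet X) (R : M → M → Prop) [hR : Def₂ R]
    (h : ∀ x, x ∈ₘ X → ∃! y, R x y) :
    ∃ f, IsFunOn f X ∧ ∀ x y, Maps f x y ↔ x ∈ₘ X ∧ R x y := by
  have := @DefPred.subst₂ (hP := hR)
  obtain ⟨f, hf, h1⟩ := exists_replacement X (fun x p => ∃ y, R x y ∧ p = opair x y) (by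
    rintro x hx p p' ⟨y, hy, rfl⟩ ⟨y', hy', rfl⟩
    rw [(h x hx).unique hy hy'])
  have h2 : ∀ x y, Maps f x y ↔ x ∈ₘ X ∧ R x y := by
    intro x y
    rw [maps_iff, h1]
    constructor
    · rintro ⟨x', hx', y', h', h''⟩
      rw [opair_inj] at h''
      obtain ⟨rfl, rfl⟩ := h''
      exact ⟨hx', h'⟩
    · rintro ⟨hx, hy⟩
      exact ⟨x, hx, y, hy, rfl⟩
  refine ⟨f, ⟨hf, hX, ?_, ?_⟩, h2⟩
  · intro p hp
    obtain ⟨x, hx, y, -, rfl⟩ := (h1 p).1 hp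
    exact ⟨x, hx, y, isOPair_iff.2 rfl⟩
  · intro x hx
    obtain ⟨y, hy, hu⟩ := h x hx
    exact ⟨y, (h2 x y).2 ⟨hx, hy⟩, fun y' h' => hu y' ((h2 x y').1 h').2⟩

/-- The axiom of choice, as uniformization of a definable relation. -/
theorem exists_choice (X Z : M) (hX : IsSet X) (Q : M → M → Prop) [hQ : Def₂ Q]
    (h : ∀ x, x ∈ₘ X → ∃ z, z ∈ₘ Z ∧ Q x z) :
    ∃ f, IsFunOn f X ∧ ∀ x y, Maps f x y → y ∈ₘ Z ∧ Q x y := by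
  have := @DefPred.subst₂ (hP := hQ)
  let T : M → M → Prop := fun x u => IsSet u ∧ ∀ z, z ∈ₘ u ↔ z ∈ₘ Z ∧ Q x z
  have hT : ∀ x u u', T x u → T x u' → u = u' := fun x u u' h h' =>
    set_ext h.1 h'.1 fun z => by rw [h.2, h'.2]
  obtain ⟨W, hWs, hW⟩ := exists_replacement X
    (fun x u => IsSet u ∧ ∀ z, z ∈ₘ u ↔ z ∈ₘ Z ∧ Q x z) fun x _ => hT x
  obtain ⟨e, he, he'⟩ := hM.out.choice W hWs (by
    intro a ha
    obtain ⟨x, hx, hs, h1⟩ := (hW a).1 ha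
    obtain ⟨z, hz⟩ := h x hx
    exact ⟨hs, z, (h1 z).2 hz⟩)
  obtain ⟨f, hf, hf'⟩ := exists_fun X hX
    (fun x y => ∃ u, (IsSet u ∧ ∀ z, z ∈ₘ u ↔ z ∈ₘ Z ∧ Q x z) ∧ Maps e u y) (by
    intro x hx
    obtain ⟨u, hu⟩ := exists_sep Z (Q x)
    obtain ⟨y, hy⟩ := he.exists_maps ((hW u).2 ⟨x, hx, hu⟩)
    refine ⟨y, ⟨u, hu, hy⟩, ?_⟩
    rintro y' ⟨u', hu', hy'⟩
    rw [hT x u' u hu' hu] at hy'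
    exact he.eq_of_maps hy' hy)
  refine ⟨f, hf, fun x y hxy => ?_⟩
  obtain ⟨hx, u, hu, hy⟩ := (hf' x y).1 hxy
  exact (hu.2 y).1 (he' _ _ hy)

theorem exists_bound_fun (X Y : M) : ∃ Z, ∀ f, IsFun f X Y → f ∈ₘ Z := by
  obtain ⟨P, hPs, hP⟩ := exists_prod X Y
  obtain ⟨Z, -, hZ⟩ := hM.out.powerset P hPs
  refine ⟨Z, fun f hf => (hZ f).2 ⟨hf.1.1, hPs, fun p hp => ?_⟩⟩
  obtain ⟨x, y, rfl, h⟩ := hf.1.eq_opair hp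
  exact (hP _).2 ⟨x, y, hf.1.mem_dom h, hf.2.2 _ _ h, rfl⟩

end Basic

/-! ### Natural numbers, recursion and induction inside a model -/

section Omega

variable {M : Type*} [SetStr M] [hM : Fact (IsModelZFAC M)]

theorem not_mem_self (x : M) : ¬ x ∈ₘ x := by
  intro h
  obtain ⟨y, hy, h'⟩ := hM.out.foundation (upair x x) ⟨x, mem_upair.2 (Or.inl rfl)⟩
  obtain rfl : y = x := by simpa using hy
  exact h' y h (by simp)

theorem not_mem_of_mem {x y : M} (h : x ∈ₘ y) : ¬ y ∈ₘ x := by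
  intro h1
  obtain ⟨z, hz, h'⟩ := hM.out.foundation (upair x y) ⟨x, mem_upair.2 (Or.inl rfl)⟩
  rcases mem_upair.1 hz with rfl | rfl
  · exact h' _ h1 (by simp)
  · exact h' _ h (by simp)

variable (M) in
/-- `∅`. -/
noncomputable def empty : M := hM.out.empty_set.choose

theorem isSet_empty : IsSet (empty M) := hM.out.empty_set.choose_spec.1

@[simp] theorem not_mem_empty {z : M} : ¬ z ∈ₘ empty M := hM.out.empty_set.choose_spec.2 z

theorem isEmptySet_iff {x : M} : IsEmptySet x ↔ x = empty M := by
  constructor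
  · rintro ⟨h1, h2⟩
    exact set_ext h1 isSet_empty fun z => by simp [h2]
  · rintro rfl
    exact ⟨isSet_empty, fun z => not_mem_empty⟩

/-- `n ∪ {n}`. -/
noncomputable def succ (n : M) : M := ins n n

@[simp] theorem mem_succ {n z : M} : z ∈ₘ succ n ↔ z ∈ₘ n ∨ z = n := mem_ins

theorem isSet_succ (n : M) : IsSet (succ n) := isSet_ins n n

instance {n : ℕ} {f : (Fin n → M) → M} [DefFun f] : DefFun fun v => succ (f v) := by
  unfold succ; infer_instance

theorem isSucc_iff {s n : M} : IsSucc s n ↔ s = succ n := eq_ins_iff.symm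

theorem succ_ne_empty (n : M) : succ n ≠ empty M := fun h =>
  not_mem_empty (h ▸ mem_succ.2 (Or.inr rfl) : n ∈ₘ empty M)

theorem succ_injective {m n : M} (h : succ m = succ n) : m = n := by
  have h1 : m ∈ₘ succ n := h ▸ mem_succ.2 (Or.inr rfl)
  have h2 : n ∈ₘ succ m := h ▸ mem_succ.2 (Or.inr rfl)
  rcases mem_succ.1 h1 with h1 | h1
  · rcases mem_succ.1 h2 with h2 | h2
    · exact absurd h2 (not_mem_of_mem h1)
    · exact h2.symm
  · exact h1

theorem isInductive_iff {w : M} :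
    IsInductive w ↔ IsSet w ∧ empty M ∈ₘ w ∧ ∀ n, n ∈ₘ w → succ n ∈ₘ w := by
  simp [IsInductive, isEmptySet_iff, isSucc_iff]

theorem exists_isOmega : ∃ w : M, IsOmega w := by
  obtain ⟨v, hv⟩ := hM.out.infinity
  obtain ⟨w, hw, h⟩ := exists_sep v fun n => ∀ u, IsInductive u → n ∈ₘ u
  refine ⟨w, isInductive_iff.2 ⟨hw, ?_, ?_⟩,
    fun u hu => ⟨hw, hu.1, fun z hz => ((h z).1 hz).2 u hu⟩⟩
  · exact (h _).2 ⟨(isInductive_iff.1 hv).2.1, fun u hu => (isInductive_iff.1 hu).2.1⟩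
  · intro n hn
    obtain ⟨h1, h2⟩ := (h n).1 hn
    exact (h _).2 ⟨(isInductive_iff.1 hv).2.2 n h1,
      fun u hu => (isInductive_iff.1 hu).2.2 n (h2 u hu)⟩

variable (M) in
/-- `ω`. -/
noncomputable def omega : M := (exists_isOmega (M := M)).choose

theorem isOmega_omega : IsOmega (omega M) := (exists_isOmega (M := M)).choose_spec

theorem isSet_omega : IsSet (omega M) := isOmega_omega.1.1

theorem empty_mem_omega : empty M ∈ₘ omega M := (isInductive_iff.1 isOmega_omega.1).2.1

theorem succ_mem_omega {n : M} (h : n ∈ₘ omega M) : succ n ∈ₘ omega M :=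
  (isInductive_iff.1 isOmega_omega.1).2.2 n h

theorem isOmega_iff {w : M} : IsOmega w ↔ w = omega M := by
  constructor
  · intro h
    exact set_ext h.1.1 isSet_omega fun z =>
      ⟨(h.2 _ isOmega_omega.1).2.2 z, (isOmega_omega.2 _ h.1).2.2 z⟩
  · rintro rfl
    exact isOmega_omega

theorem omega_induction (P : M → Prop) [Def₁ P] (h0 : P (empty M))
    (hs : ∀ n, n ∈ₘ omega M → P n → P (succ n)) : ∀ n, n ∈ₘ omega M → P n := by
  obtain ⟨v, hv, h⟩ := exists_sep (omega M) P
  have hi : IsInductive v := isInductive_iff.2 ⟨hv, (h _).2 ⟨empty_mem_omega, h0⟩, fun n hn =>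
    (h _).2 ⟨succ_mem_omega ((h n).1 hn).1, hs n ((h n).1 hn).1 ((h n).1 hn).2⟩⟩
  exact fun n hn => ((h n).1 ((isOmega_omega.2 v hi).2.2 n hn)).2

/-- Recursion on `ω` along a definable class function `S`. The approximations are the sets of pairs
each of which is the initial pair or comes from another pair of the set by one recursion step; so
they need not be functions, and no ordering of `ω` is involved. -/
theorem exists_rec (S : M → M → Prop) [hS : Def₂ S] (h : ∀ x, ∃! y, S x y) (x₀ : M) :
    ∃ f, IsFunOn f (omega M) ∧ Maps f (empty M) x₀ ∧
      ∀ n x y, Maps f n x → S x y → Maps f (succ n) y := by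
  have := @DefPred.subst₂ (hP := hS)
  let C : M → Prop := fun g => ∀ p, p ∈ₘ g → p = opair (empty M) x₀ ∨
    ∃ k z y, opair k z ∈ₘ g ∧ S z y ∧ p = opair (succ k) y
  let R : M → M → Prop := fun n y => ∃ g, C g ∧ opair n y ∈ₘ g
  have hR : Def₂ R := by
    change DefPred fun v : Fin 2 → M => ∃ g, (∀ p, p ∈ₘ g → p = opair (empty M) x₀ ∨
      ∃ k z y, opair k z ∈ₘ g ∧ S z y ∧ p = opair (succ k) y) ∧ opair (v 0) (v 1) ∈ₘ g
    infer_instance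
  have hR' := @DefPred.subst₂ (hP := hR)
  have h0 : R (empty M) x₀ :=
    ⟨upair (opair (empty M) x₀) (opair (empty M) x₀), fun p hp => Or.inl (by simpa using hp),
      by simp⟩
  have hs : ∀ n x y, R n x → S x y → R (succ n) y := by
    rintro n x y ⟨g, hg, hx⟩ hxy
    refine ⟨ins g (opair (succ n) y), fun p hp => ?_, mem_ins.2 (Or.inr rfl)⟩
    rcases mem_ins.1 hp with hp | rfl
    · rcases hg p hp with hp | ⟨k, z, y, h1, h2⟩
      · exact Or.inl hp
      · exact Or.inr ⟨k, z, y, mem_ins.2 (Or.inl h1), h2⟩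
    · exact Or.inr ⟨n, x, y, mem_ins.2 (Or.inl hx), hxy, rfl⟩
  have hex : ∀ n, n ∈ₘ omega M → ∃! y, R n y := by
    apply omega_induction
    · refine ⟨x₀, h0, ?_⟩
      rintro y ⟨g, hg, hy⟩
      rcases hg _ hy with h1 | ⟨k, z, y, -, -, h1⟩
      · exact (opair_inj.1 h1).2
      · exact absurd (opair_inj.1 h1).1.symm (succ_ne_empty k)
    · rintro n hn ⟨x, hx, hu⟩
      obtain ⟨y, hy, hy'⟩ := h x
      refine ⟨y, hs n x y hx hy, ?_⟩
      rintro y' ⟨g, hg, h1⟩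
      rcases hg _ h1 with h1 | ⟨k, z, y'', h3, h4, h1⟩
      · exact absurd (opair_inj.1 h1).1 (succ_ne_empty n)
      · obtain ⟨h5, rfl⟩ := opair_inj.1 h1
        obtain rfl := succ_injective h5
        obtain rfl := hu z ⟨g, hg, h3⟩
        exact hy' _ h4
  obtain ⟨f, hf, hf'⟩ := exists_fun (omega M) isSet_omega R hex
  refine ⟨f, hf, (hf' _ _).2 ⟨empty_mem_omega, h0⟩, fun n x y h1 h2 => ?_⟩
  obtain ⟨h3, h4⟩ := (hf' _ _).1 h1
  exact (hf' _ _).2 ⟨succ_mem_omega h3, hs n x y h4 h2⟩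

/-- Every object belongs to a transitive set, the union of its iterated unions. -/
theorem exists_transitive (x : M) : ∃ t, IsTransitiveSet t ∧ x ∈ₘ t := by
  obtain ⟨f, hf, h0, hs⟩ := exists_rec (fun u v : M => v = sUnion u)
    (fun u => ⟨sUnion u, rfl, fun _ h => h⟩) (upair x x)
  obtain ⟨r, hr, hr'⟩ := exists_replacement (omega M) (fun n u => Maps f n u)
    fun n _ u u' => hf.eq_of_maps
  refine ⟨sUnion r, ⟨isSet_sUnion r, fun y hy z hz => ?_⟩, ?_⟩
  · obtain ⟨u, hu, hyu⟩ := mem_sUnion.1 hy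
    obtain ⟨n, hn, h⟩ := (hr' u).1 hu
    exact mem_sUnion.2 ⟨sUnion u, (hr' _).2 ⟨_, succ_mem_omega hn, hs n u _ h rfl⟩,
      mem_sUnion.2 ⟨y, hyu, hz⟩⟩
  · exact mem_sUnion.2 ⟨_, (hr' _).2 ⟨_, empty_mem_omega, h0⟩, by simp⟩

/-- Induction along `∈` for definable predicates. -/
theorem mem_induction (P : M → Prop) [hP : Def₁ P] (h : ∀ x, (∀ z, z ∈ₘ x → P z) → P x) :
    ∀ x, P x := by
  have := @DefPred.subst₁ (hP := hP)
  intro x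
  by_contra hx
  obtain ⟨t, ht, hxt⟩ := exists_transitive x
  obtain ⟨u, hu, h1⟩ := exists_sep t fun y => ¬ P y
  obtain ⟨y, hy, h2⟩ := hM.out.foundation u ⟨x, (h1 x).2 ⟨hxt, hx⟩⟩
  obtain ⟨hyt, hy'⟩ := (h1 y).1 hy
  refine hy' (h y fun z hz => ?_)
  by_contra hz'
  exact h2 z hz ((h1 z).2 ⟨ht.2 y hyt z hz, hz'⟩)

/-! ### Countability inside a model -/

theorem trans_of_mem_omega : ∀ n : M, n ∈ₘ omega M → ∀ y, y ∈ₘ n → ∀ z, z ∈ₘ y → z ∈ₘ n := by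
  apply omega_induction
  · simp
  · intro n hn ih y hy z hz
    rcases mem_succ.1 hy with hy | rfl
    · exact mem_succ.2 (Or.inl (ih y hy z hz))
    · exact mem_succ.2 (Or.inl hz)

theorem empty_le : ∀ n : M, n ∈ₘ omega M → empty M ∈ₘ n ∨ empty M = n := by
  apply omega_induction
  · exact Or.inr rfl
  · intro n _ ih
    exact Or.inl (mem_succ.2 ih)

theorem succ_le_of_mem : ∀ n : M, n ∈ₘ omega M → ∀ m, m ∈ₘ n → succ m ∈ₘ n ∨ succ m = n := by
  apply omega_induction
  · simp
  · intro n _ ih m hm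
    rcases mem_succ.1 hm with hm | rfl
    · exact Or.inl (mem_succ.2 (ih m hm))
    · exact Or.inr rfl

theorem exists_common_bound (n : M) (hn : n ∈ₘ omega M) : ∀ m, m ∈ₘ omega M →
    ∃ k, k ∈ₘ omega M ∧ (m ∈ₘ k ∨ m = k) ∧ (n ∈ₘ k ∨ n = k) := by
  apply omega_induction
  · exact ⟨n, hn, empty_le n hn, Or.inr rfl⟩
  · rintro m _ ⟨k, hk, h1 | rfl, h2⟩
    · exact ⟨k, hk, succ_le_of_mem k hk m h1, h2⟩
    · exact ⟨succ m, succ_mem_omega hk, Or.inr rfl, Or.inl (mem_succ.2 h2)⟩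

/-- Induction up to and including `k`. -/
theorem bounded_induction (P : M → Prop) [hP : Def₁ P] {k : M} (hk : k ∈ₘ omega M)
    (h0 : P (empty M)) (hs : ∀ n, n ∈ₘ k → P n → P (succ n)) :
    ∀ n, n ∈ₘ omega M → n ∈ₘ k ∨ n = k → P n := by
  have := @DefPred.subst₁ (hP := hP)
  apply omega_induction
  · exact fun _ => h0
  · intro n _ ih hn
    have h1 : n ∈ₘ k := by
      rcases hn with hn | rfl
      · exact trans_of_mem_omega k hk _ hn n (mem_succ.2 (Or.inr rfl))
      · exact mem_succ.2 (Or.inr rfl)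
    exact hs n h1 (ih (Or.inl h1))

/-- A sequence that runs through all pairs of natural numbers. It enumerates the triples
`⟨⟨a, b⟩, k⟩` with `a, b ≤ k`, lexicographically in `k`, `b`, `a`; the third entry makes the
successor of a triple definable without arithmetic. -/
theorem exists_enum_pairs : ∃ f : M, IsFunOn f (omega M) ∧ ∀ a b, a ∈ₘ omega M → b ∈ₘ omega M →
    ∃ n k, n ∈ₘ omega M ∧ Maps f n (opair (opair a b) k) := by
  let e := empty M
  let S : M → M → Prop := fun p q =>
    (∃ a b k, p = opair (opair a b) k ∧ ((a ∈ₘ k ∧ q = opair (opair (succ a) b) k) ∨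
      (¬ a ∈ₘ k ∧ b ∈ₘ k ∧ q = opair (opair e (succ b)) k) ∨
      (¬ a ∈ₘ k ∧ ¬ b ∈ₘ k ∧ q = opair (opair e e) (succ k)))) ∨
    (¬ ∃ a b k, p = opair (opair a b) k) ∧ q = p
  have hS : Def₂ S := by
    change DefPred fun v : Fin 2 → M =>
      (∃ a b k, v 0 = opair (opair a b) k ∧ ((a ∈ₘ k ∧ v 1 = opair (opair (succ a) b) k) ∨
        (¬ a ∈ₘ k ∧ b ∈ₘ k ∧ v 1 = opair (opair e (succ b)) k) ∨
        (¬ a ∈ₘ k ∧ ¬ b ∈ₘ k ∧ v 1 = opair (opair e e) (succ k)))) ∨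
      (¬ ∃ a b k, v 0 = opair (opair a b) k) ∧ v 1 = v 0
    infer_instance
  have hSu : ∀ p, ∃! q, S p q := by
    intro p
    by_cases hp : ∃ a b k, p = opair (opair a b) k
    · obtain ⟨a, b, k, rfl⟩ := hp
      simp only [S, opair_inj]
      by_cases h1 : a ∈ₘ k
      · refine ⟨opair (opair (succ a) b) k, Or.inl ⟨a, b, k, by simp, by simp [h1]⟩, ?_⟩
        rintro q (⟨a', b', k', ⟨⟨rfl, rfl⟩, rfl⟩, h⟩ | ⟨h, -⟩)
        · simpa [h1] using h
        · exact absurd ⟨a, b, k, by simp⟩ h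
      · by_cases h2 : b ∈ₘ k
        · refine ⟨opair (opair e (succ b)) k, Or.inl ⟨a, b, k, by simp, by simp [h1, h2]⟩, ?_⟩
          rintro q (⟨a', b', k', ⟨⟨rfl, rfl⟩, rfl⟩, h⟩ | ⟨h, -⟩)
          · simpa [h1, h2] using h
          · exact absurd ⟨a, b, k, by simp⟩ h
        · refine ⟨opair (opair e e) (succ k), Or.inl ⟨a, b, k, by simp, by simp [h1, h2]⟩, ?_⟩
          rintro q (⟨a', b', k', ⟨⟨rfl, rfl⟩, rfl⟩, h⟩ | ⟨h, -⟩)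
          · simpa [h1, h2] using h
          · exact absurd ⟨a, b, k, by simp⟩ h
    · exact ⟨p, Or.inr ⟨hp, rfl⟩, fun q hq => hq.elim
        (fun ⟨a, b, k, h, _⟩ => absurd ⟨a, b, k, h⟩ hp) fun h => h.2⟩
  obtain ⟨f, hf, hf0, hfs⟩ := exists_rec S hSu (opair (opair e e) e)
  let V : M → M → M → Prop := fun a b k => ∃ n, Maps f n (opair (opair a b) k)
  have hV1 : ∀ a b k, V a b k → a ∈ₘ k → V (succ a) b k := fun a b k ⟨n, h⟩ ha =>
    ⟨succ n, hfs n _ _ h (Or.inl ⟨a, b, k, rfl, Or.inl ⟨ha, rfl⟩⟩)⟩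
  have hV2 : ∀ a b k, V a b k → ¬ a ∈ₘ k → b ∈ₘ k → V e (succ b) k := fun a b k ⟨n, h⟩ ha hb =>
    ⟨succ n, hfs n _ _ h (Or.inl ⟨a, b, k, rfl, Or.inr (Or.inl ⟨ha, hb, rfl⟩)⟩)⟩
  have hV3 : ∀ a b k, V a b k → ¬ a ∈ₘ k → ¬ b ∈ₘ k → V e e (succ k) := fun a b k ⟨n, h⟩ ha hb =>
    ⟨succ n, hfs n _ _ h (Or.inl ⟨a, b, k, rfl, Or.inr (Or.inr ⟨ha, hb, rfl⟩)⟩)⟩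
  have hrow : ∀ k, k ∈ₘ omega M → ∀ b, V e b k →
      ∀ a, a ∈ₘ omega M → a ∈ₘ k ∨ a = k → V a b k := fun k hk b hb =>
    bounded_induction (fun a => ∃ n, Maps f n (opair (opair a b) k)) hk hb
      fun a ha h => hV1 a b k h ha
  have hcol : ∀ k, k ∈ₘ omega M → V e e k →
      ∀ b, b ∈ₘ omega M → b ∈ₘ k ∨ b = k → V e b k := fun k hk h0 =>
    bounded_induction (fun b => ∃ n, Maps f n (opair (opair e b) k)) hk h0
      fun b hb h => hV2 k b k (hrow k hk b h k hk (Or.inr rfl)) (not_mem_self k) hb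
  have hdiag : ∀ k, k ∈ₘ omega M → V e e k :=
    omega_induction (fun k => ∃ n, Maps f n (opair (opair e e) k)) ⟨_, hf0⟩ fun k hk h0 =>
      hV3 k k k (hrow k hk k (hcol k hk h0 k hk (Or.inr rfl)) k hk (Or.inr rfl))
        (not_mem_self k) (not_mem_self k)
  refine ⟨f, hf, fun a b ha hb => ?_⟩
  obtain ⟨k, hk, h1, h2⟩ := exists_common_bound b hb a ha
  obtain ⟨n, hn⟩ := hrow k hk b (hcol k hk (hdiag k hk) b hb h2) a ha h1
  exact ⟨n, k, hf.mem_dom hn, hn⟩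

theorem isCountableSet_iff {x : M} : IsCountableSet x ↔ ∃ f, IsInj f x (omega M) := by
  simp [IsCountableSet, isOmega_iff]

/-- A set is countable if a definable partial class function maps `ω` onto it. -/
theorem isCountableSet_of_rel (Y : M) (hY : IsSet Y) (R : M → M → Prop) [hR : Def₂ R]
    (hex : ∀ y, y ∈ₘ Y → ∃ n, n ∈ₘ omega M ∧ R n y)
    (hun : ∀ n y y', n ∈ₘ omega M → y ∈ₘ Y → y' ∈ₘ Y → R n y → R n y' → y = y') :
    IsCountableSet Y := by
  have := @DefPred.subst₂ (hP := hR)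
  obtain ⟨f, hf, h⟩ := exists_choice Y (omega M) hY (fun y n => R n y) hex
  rw [isCountableSet_iff]
  exact ⟨f, ⟨hf, isSet_omega, fun x y hxy => (h x y hxy).1⟩, fun x x' n hx hx' =>
    hun n x x' (h _ _ hx).1 (hf.mem_dom hx) (hf.mem_dom hx') (h _ _ hx).2 (h _ _ hx').2⟩

/-- The image of a countable set under a definable partial class function is countable. -/
theorem IsCountableSet.of_rel {X : M} (hX : IsCountableSet X) (Y : M) (hY : IsSet Y)
    (R : M → M → Prop) [hR : Def₂ R] (hex : ∀ y, y ∈ₘ Y → ∃ x, x ∈ₘ X ∧ R x y)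
    (hun : ∀ x y y', x ∈ₘ X → y ∈ₘ Y → y' ∈ₘ Y → R x y → R x y' → y = y') :
    IsCountableSet Y := by
  have := @DefPred.subst₂ (hP := hR)
  obtain ⟨i, hi⟩ := isCountableSet_iff.1 hX
  refine isCountableSet_of_rel Y hY (fun n y => ∃ x, Maps i x n ∧ R x y) ?_ ?_
  · intro y hy
    obtain ⟨x, hx, h⟩ := hex y hy
    obtain ⟨n, hn⟩ := hi.1.1.exists_maps hx
    exact ⟨n, hi.1.2.2 _ _ hn, x, hn, h⟩
  · rintro n y y' _ hy hy' ⟨x, hx, h⟩ ⟨x', hx', h'⟩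
    obtain rfl := hi.2 _ _ _ hx hx'
    exact hun x y y' (hi.1.1.mem_dom hx) hy hy' h h'

/-- A countable union of countable sets is countable. -/
theorem isCountableSet_iUnion {X : M} (hX : IsCountableSet X) (Y : M) (hY : IsSet Y)
    (E : M → M → Prop) [hE : Def₂ E] (hex : ∀ y, y ∈ₘ Y → ∃ x, x ∈ₘ X ∧ E x y)
    (hcount : ∀ x, x ∈ₘ X → ∀ u, IsSet u → (∀ y, y ∈ₘ u ↔ y ∈ₘ Y ∧ E x y) → IsCountableSet u) :
    IsCountableSet Y := by
  have := @DefPred.subst₂ (hP := hE)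
  obtain ⟨i, hi⟩ := isCountableSet_iff.1 hX
  -- `g x` is an injective relation from the section of `E` at `x` to `ω`.
  obtain ⟨P, hPs, hP⟩ := exists_prod Y (omega M)
  obtain ⟨W, -, hW⟩ := hM.out.powerset P hPs
  obtain ⟨g, hg, hg'⟩ := exists_choice X W hi.1.1.2.1
    (fun x j => (∀ y, y ∈ₘ Y → E x y → ∃ n, n ∈ₘ omega M ∧ Maps j y n) ∧
      ∀ y y' n, Maps j y n → Maps j y' n → y = y') (by
    intro x hx
    obtain ⟨u, hus, hu⟩ := exists_sep Y (E x)
    obtain ⟨j, hj⟩ := isCountableSet_iff.1 (hcount x hx u hus hu)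
    refine ⟨j, (hW j).2 ⟨hj.1.1.1, hPs, fun p hp => ?_⟩, fun y hy hxy => ?_, hj.2⟩
    · obtain ⟨y, n, rfl, h⟩ := hj.1.1.eq_opair hp
      exact (hP _).2 ⟨y, n, ((hu y).1 (hj.1.1.mem_dom h)).1, hj.1.2.2 _ _ h, rfl⟩
    · obtain ⟨n, hn⟩ := hj.1.1.exists_maps ((hu y).2 ⟨hy, hxy⟩)
      exact ⟨n, hj.1.2.2 _ _ hn, hn⟩)
  obtain ⟨f, hf, hf'⟩ := exists_enum_pairs (M := M)
  refine isCountableSet_of_rel Y hY (fun n y => ∃ a b k x j, Maps f n (opair (opair a b) k) ∧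
    Maps i x a ∧ Maps g x j ∧ Maps j y b) ?_ ?_
  · intro y hy
    obtain ⟨x, hx, hxy⟩ := hex y hy
    obtain ⟨a, ha⟩ := hi.1.1.exists_maps hx
    obtain ⟨j, hj⟩ := hg.exists_maps hx
    obtain ⟨b, hb, hb'⟩ := (hg' x j hj).2.1 y hy hxy
    obtain ⟨n, k, hn, h⟩ := hf' a b (hi.1.2.2 _ _ ha) hb
    exact ⟨n, hn, a, b, k, x, j, h, ha, hj, hb'⟩
  · rintro n y y' - - - ⟨a, b, k, x, j, h1, h2, h3, h4⟩ ⟨a', b', k', x', j', h1', h2', h3', h4'⟩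
    have h5 := hf.eq_of_maps h1 h1'
    rw [opair_inj, opair_inj] at h5
    obtain ⟨⟨rfl, rfl⟩, rfl⟩ := h5
    obtain rfl := hi.2 _ _ _ h2 h2'
    obtain rfl := hg.eq_of_maps h3 h3'
    exact (hg' x j h3).2.2 _ _ _ h4 h4'

end Omega

/-! ### The action of permutations of the atoms -/

section Action

variable {M : Type*} [SetStr M]

/-- `φ` is a permutation of the atoms. -/
def IsAtomPerm (φ : M) : Prop := ∃ A, IsAtomSet A ∧ IsBij φ A A

/-- A map of the universe into itself that is given by the recursion `π(x) = {π(z) : z ∈ x}` above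
its values at the atoms. -/
structure IsHom (π : M → M) : Prop where
  atom : ∀ a, SetStr.IsAtom a → SetStr.IsAtom (π a)
  isSet : ∀ x, IsSet x → IsSet (π x)
  mem : ∀ x, IsSet x → ∀ z, z ∈ₘ π x ↔ ∃ w, w ∈ₘ x ∧ z = π w

variable [hM : Fact (IsModelZFAC M)]

omit hM in
theorem IsHom.comp {π ρ : M → M} (hπ : IsHom π) (hρ : IsHom ρ) : IsHom fun x => π (ρ x) where
  atom a ha := hπ.atom _ (hρ.atom a ha)
  isSet x hx := hπ.isSet _ (hρ.isSet x hx)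
  mem x hx z := by
    rw [hπ.mem _ (hρ.isSet x hx)]
    constructor
    · rintro ⟨w, hw, rfl⟩
      obtain ⟨u, hu, rfl⟩ := (hρ.mem x hx w).1 hw
      exact ⟨u, hu, rfl⟩
    · rintro ⟨u, hu, rfl⟩
      exact ⟨_, (hρ.mem x hx _).2 ⟨u, hu, rfl⟩, rfl⟩

omit hM in
theorem IsHom.id : IsHom fun x : M => x where
  atom _ ha := ha
  isSet _ hx := hx
  mem _ _ z := ⟨fun h => ⟨z, h, rfl⟩, fun ⟨_, h, e⟩ => e ▸ h⟩

/-- A definable map obeying the recursion is determined by its values at the atoms. -/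
theorem IsHom.ext {π ρ : M → M} (hπ : IsHom π) (hρ : IsHom ρ) [dπ : DefFun₁ π] [dρ : DefFun₁ ρ]
    (h : ∀ a, SetStr.IsAtom a → π a = ρ a) : ∀ x, π x = ρ x := by
  apply mem_induction
  intro x ih
  by_cases hx : IsSet x
  · refine set_ext (hπ.isSet x hx) (hρ.isSet x hx) fun z => ?_
    rw [hπ.mem x hx, hρ.mem x hx]
    exact exists_congr fun w => and_congr_right fun hw => by rw [ih w hw]
  · exact h x (not_not.1 hx)

variable {φ x y : M}

theorem IsAtomPerm.actsTo_unique (hφ : IsAtomPerm φ) :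
    ∀ x y y', ActsTo φ x y → ActsTo φ x y' → y = y' := by
  obtain ⟨A, -, hA⟩ := hφ
  apply mem_induction
  rintro x ih y y' ⟨t, f, ht, hf, ha, hs, hxy⟩ ⟨t', f', ht', hf', ha', hs', hxy'⟩
  by_cases hx : IsSet x
  · obtain ⟨h1, h2⟩ := hs x y hx hxy
    obtain ⟨h1', h2'⟩ := hs' x y' hx hxy'
    refine set_ext h1 h1' fun z' => ⟨fun hz => ?_, fun hz => ?_⟩
    · obtain ⟨z, hzx, h⟩ := (h2 z').1 hz
      obtain ⟨z'', h'⟩ := hf'.exists_maps (ht'.2 x (hf'.mem_dom hxy') z hzx)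
      obtain rfl := ih z hzx z' z'' ⟨t, f, ht, hf, ha, hs, h⟩ ⟨t', f', ht', hf', ha', hs', h'⟩
      exact (h2' _).2 ⟨z, hzx, h'⟩
    · obtain ⟨z, hzx, h⟩ := (h2' z').1 hz
      obtain ⟨z'', h'⟩ := hf.exists_maps (ht.2 x (hf.mem_dom hxy) z hzx)
      obtain rfl := ih z hzx z'' z' ⟨t, f, ht, hf, ha, hs, h'⟩ ⟨t', f', ht', hf', ha', hs', h⟩
      exact (h2 _).2 ⟨z, hzx, h'⟩
  · exact hA.1.1.1.eq_of_maps (ha x y (not_not.1 hx) hxy) (ha' x y' (not_not.1 hx) hxy')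

omit hM in
theorem ActsTo.maps (h : ActsTo φ x y) (hx : SetStr.IsAtom x) : Maps φ x y := by
  obtain ⟨t, f, -, -, ha, -, hxy⟩ := h
  exact ha x y hx hxy

theorem ActsTo.exists_of_mem (h : ActsTo φ x y) {z : M} (hz : z ∈ₘ x) : ∃ z', ActsTo φ z z' := by
  obtain ⟨t, f, ht, hf, ha, hs, hxy⟩ := h
  obtain ⟨z', h'⟩ := hf.exists_maps (ht.2 x (hf.mem_dom hxy) z hz)
  exact ⟨z', t, f, ht, hf, ha, hs, h'⟩

theorem IsAtomPerm.mem_of_actsTo (hφ : IsAtomPerm φ) (h : ActsTo φ x y) (hx : IsSet x) :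
    IsSet y ∧ ∀ z', z' ∈ₘ y ↔ ∃ z, z ∈ₘ x ∧ ActsTo φ z z' := by
  obtain ⟨t, f, ht, hf, ha, hs, hxy⟩ := h
  obtain ⟨h1, h2⟩ := hs x y hx hxy
  refine ⟨h1, fun z' => (h2 z').trans (exists_congr fun z => and_congr_right fun hz => ?_)⟩
  refine ⟨fun h => ⟨t, f, ht, hf, ha, hs, h⟩, fun h => ?_⟩
  obtain ⟨z'', h'⟩ := hf.exists_maps (ht.2 x (hf.mem_dom hxy) z hz)
  obtain rfl := hφ.actsTo_unique z z' z'' h ⟨t, f, ht, hf, ha, hs, h'⟩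
  exact h'

/-- Every permutation of the atoms acts on the whole universe. For the induction step at `x`, the
recursion is defined on `x` together with those elements of a transitive set containing `x` on
which the action is already known. -/
theorem IsAtomPerm.exists_actsTo (hφ : IsAtomPerm φ) : ∀ x, ∃ y, ActsTo φ x y := by
  apply mem_induction
  intro x ih
  by_contra hx
  obtain ⟨v, hva, hvs⟩ : ∃ v, (SetStr.IsAtom x → Maps φ x v) ∧
      (IsSet x → IsSet v ∧ ∀ z', z' ∈ₘ v ↔ ∃ z, z ∈ₘ x ∧ ActsTo φ z z') := by
    by_cases h : IsSet x
    · obtain ⟨v, hv⟩ := exists_replacement x (fun z z' => ActsTo φ z z')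
        fun z _ => hφ.actsTo_unique z
      exact ⟨v, fun h' => absurd h' h, fun _ => hv⟩
    · obtain ⟨A, hA, hb⟩ := hφ
      obtain ⟨v, hv⟩ := hb.1.1.1.exists_maps ((hA.2 x).2 (not_not.1 h))
      exact ⟨v, fun _ => hv, fun h' => absurd h' h⟩
  obtain ⟨t₀, ht₀, hxt₀⟩ := exists_transitive x
  obtain ⟨t, hts, ht⟩ := exists_sep t₀ fun z => (∃ z', ActsTo φ z z') ∨ z = x
  have htt : IsTransitiveSet t := by
    refine ⟨hts, fun y hy z hz => ?_⟩
    obtain ⟨h1, h2⟩ := (ht y).1 hy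
    refine (ht z).2 ⟨ht₀.2 y h1 z hz, Or.inl ?_⟩
    rcases h2 with ⟨y', h2⟩ | rfl
    · exact h2.exists_of_mem hz
    · exact ih z hz
  obtain ⟨f, hf, hf'⟩ := exists_fun t hts (fun z z' => ActsTo φ z z' ∨ (z = x ∧ z' = v)) (by
    intro z hz
    rcases ((ht z).1 hz).2 with ⟨z', h⟩ | rfl
    · refine ⟨z', Or.inl h, ?_⟩
      rintro z'' (h' | ⟨rfl, -⟩)
      · exact hφ.actsTo_unique _ _ _ h' h
      · exact absurd ⟨z', h⟩ hx
    · refine ⟨v, Or.inr ⟨rfl, rfl⟩, ?_⟩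
      rintro z'' (h' | ⟨-, rfl⟩)
      · exact absurd ⟨z'', h'⟩ hx
      · rfl)
  have hxt : x ∈ₘ t := (ht x).2 ⟨hxt₀, Or.inr rfl⟩
  refine hx ⟨v, t, f, htt, hf, ?_, ?_, (hf' _ _).2 ⟨hxt, Or.inr ⟨rfl, rfl⟩⟩⟩
  · intro a b ha h
    rcases ((hf' a b).1 h).2 with h | ⟨rfl, rfl⟩
    · exact h.maps ha
    · exact hva ha
  · intro u w hu h
    obtain ⟨hut, h⟩ := (hf' u w).1 h
    have key : ∀ z, z ∈ₘ u → ∀ z', Maps f z z' ↔ ActsTo φ z z' := by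
      intro z hz z'
      rw [hf']
      constructor
      · rintro ⟨-, h1 | ⟨rfl, rfl⟩⟩
        · exact h1
        · rcases h with h | ⟨rfl, rfl⟩
          · exact absurd (h.exists_of_mem hz) hx
          · exact absurd hz (not_mem_self _)
      · exact fun h1 => ⟨htt.2 u hut z hz, Or.inl h1⟩
    have h2 : IsSet w ∧ ∀ z', z' ∈ₘ w ↔ ∃ z, z ∈ₘ u ∧ ActsTo φ z z' := by
      rcases h with h | ⟨rfl, rfl⟩
      · exact hφ.mem_of_actsTo h hu
      · exact hvs hu
    exact ⟨h2.1, fun z' => (h2.2 z').trans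
      (exists_congr fun z => and_congr_right fun hz => (key z hz z').symm)⟩

open Classical in
/-- The value `φ(x)` of the extension of the permutation `φ` of the atoms to the universe; it is
`x` if `φ` is not a permutation of the atoms. -/
noncomputable def act (φ x : M) : M := if h : ∃ y, ActsTo φ x y then h.choose else x

theorem IsAtomPerm.actsTo_iff (hφ : IsAtomPerm φ) : ActsTo φ x y ↔ y = act φ x := by
  have h : ActsTo φ x (act φ x) := by
    have h1 := hφ.exists_actsTo x
    rw [act, dif_pos h1]
    exact h1.choose_spec
  exact ⟨fun h' => hφ.actsTo_unique _ _ _ h' h, fun h' => h' ▸ h⟩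

theorem IsAtomPerm.defFun_act (hφ : IsAtomPerm φ) : DefFun₁ (act φ) :=
  DefFun.of_graph <| DefPred.congr (P := fun w : Fin 2 → M => ActsTo φ (w 1) (w 0)) inferInstance
    fun _ => hφ.actsTo_iff

theorem IsAtomPerm.maps_act (hφ : IsAtomPerm φ) (hx : SetStr.IsAtom x) : Maps φ x (act φ x) :=
  (hφ.actsTo_iff.2 rfl).maps hx

theorem IsAtomPerm.isHom_act (hφ : IsAtomPerm φ) : IsHom (act φ) where
  atom a ha := by
    obtain ⟨A, hA, hb⟩ := id hφ
    exact (hA.2 _).1 (hb.1.1.2.2 _ _ (hφ.maps_act ha))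
  isSet x hx := (hφ.mem_of_actsTo (hφ.actsTo_iff.2 rfl) hx).1
  mem x hx z := by
    simp only [(hφ.mem_of_actsTo (hφ.actsTo_iff.2 rfl) hx).2, hφ.actsTo_iff]

end Action

section System

variable {M : Type*} [SetStr M] [hM : Fact (IsModelZFAC M)]

/-- `F` is a normal filter of subgroups of the group `G` of permutations of the set `A` of all
atoms. -/
structure PermSystem (A G F : M) : Prop where
  atoms : IsAtomSet A
  group : IsPermGroup G A
  filter : IsNormalFilter F G A

namespace PermSystem

variable {A G F : M} (S : PermSystem A G F) {φ ψ x y z f : M}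
include S

omit hM in
theorem perm (hφ : φ ∈ₘ G) : IsAtomPerm φ := ⟨A, S.atoms, S.group.2.1 φ hφ⟩

theorem actsTo_iff (hφ : φ ∈ₘ G) : ActsTo φ x y ↔ y = act φ x := (S.perm hφ).actsTo_iff

theorem act_eq_of_maps (hφ : φ ∈ₘ G) (hx : SetStr.IsAtom x) (h : Maps φ x y) : act φ x = y :=
  (S.group.2.1 φ hφ).1.1.1.eq_of_maps ((S.perm hφ).maps_act hx) h

theorem act_eq_self (hφ : φ ∈ₘ G) (h : ∀ a, a ∈ₘ A → Maps φ a a) (x : M) : act φ x = x := by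
  have := (S.perm hφ).defFun_act
  exact (S.perm hφ).isHom_act.ext IsHom.id
    (fun a ha => S.act_eq_of_maps hφ ha (h a ((S.atoms.2 a).2 ha))) x

theorem act_comp {χ : M} (hφ : φ ∈ₘ G) (hψ : ψ ∈ₘ G) (hχ : χ ∈ₘ G)
    (h : ∀ a b c, Maps ψ a b → Maps φ b c → Maps χ a c) (x : M) :
    act χ x = act φ (act ψ x) := by
  have h1 := (S.perm hφ).defFun_act
  have h2 := (S.perm hψ).defFun_act
  have h3 := (S.perm hχ).defFun_act
  have h4 : DefFun₁ fun x => act φ (act ψ x) := DefFun.subst₁ h1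
  exact (S.perm hχ).isHom_act.ext ((S.perm hφ).isHom_act.comp (S.perm hψ).isHom_act)
    (fun a ha => S.act_eq_of_maps hχ ha (h a _ _ ((S.perm hψ).maps_act ha)
      ((S.perm hφ).maps_act ((S.perm hψ).isHom_act.atom a ha)))) x

theorem act_act_of_inverse (hφ : φ ∈ₘ G) (hψ : ψ ∈ₘ G) (h : ∀ a b, Maps φ a b → Maps ψ b a)
    (x : M) : act ψ (act φ x) = x := by
  have h1 := (S.perm hφ).defFun_act
  have h2 := (S.perm hψ).defFun_act
  have h4 : DefFun₁ fun x => act ψ (act φ x) := DefFun.subst₁ h2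
  exact ((S.perm hψ).isHom_act.comp (S.perm hφ).isHom_act).ext IsHom.id
    (fun a ha => S.act_eq_of_maps hψ ((S.perm hφ).isHom_act.atom a ha)
      (h _ _ ((S.perm hφ).maps_act ha))) x

theorem exists_inv (hφ : φ ∈ₘ G) :
    ∃ ψ, ψ ∈ₘ G ∧ (∀ x, act ψ (act φ x) = x) ∧ ∀ x, act φ (act ψ x) = x := by
  obtain ⟨ψ, hψ, h⟩ := S.group.2.2.2.2 φ hφ
  obtain ⟨χ, hχ, h'⟩ := S.group.2.2.2.2 ψ hψ
  have h1 := S.act_act_of_inverse hφ hψ h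
  have h2 := S.act_act_of_inverse hψ hχ h'
  refine ⟨ψ, hψ, h1, fun x => ?_⟩
  have h3 := h1 (act ψ x)
  have h4 := h2 (act φ (act ψ x))
  rw [h3, h2] at h4
  exact h4.symm

theorem act_inj (hφ : φ ∈ₘ G) : act φ x = act φ y ↔ x = y := by
  obtain ⟨ψ, -, h, -⟩ := S.exists_inv hφ
  exact ⟨fun h' => by rw [← h x, h', h], fun h' => h' ▸ rfl⟩

theorem isSet_act (hφ : φ ∈ₘ G) (hx : IsSet x) : IsSet (act φ x) := (S.perm hφ).isHom_act.isSet x hx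

theorem mem_act (hφ : φ ∈ₘ G) (hx : IsSet x) : z ∈ₘ act φ x ↔ ∃ w, w ∈ₘ x ∧ z = act φ w :=
  (S.perm hφ).isHom_act.mem x hx z

theorem isSet_act_iff (hφ : φ ∈ₘ G) : IsSet (act φ x) ↔ IsSet x := by
  refine ⟨fun h => ?_, S.isSet_act hφ⟩
  by_contra hx
  exact h ((S.perm hφ).isHom_act.atom x (not_not.1 hx))

theorem act_mem_act (hφ : φ ∈ₘ G) : act φ z ∈ₘ act φ x ↔ z ∈ₘ x := by
  by_cases hx : IsSet x
  · rw [S.mem_act hφ hx]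
    exact ⟨fun ⟨w, hw, h⟩ => (S.act_inj hφ).1 h ▸ hw, fun h => ⟨z, h, rfl⟩⟩
  · exact iff_of_false (fun h => hx ((S.isSet_act_iff hφ).1 (isSet_of_mem h)))
      fun h => hx (isSet_of_mem h)

theorem act_upair (hφ : φ ∈ₘ G) : act φ (upair x y) = upair (act φ x) (act φ y) := by
  refine set_ext (S.isSet_act hφ (isSet_upair x y)) (isSet_upair _ _) fun z => ?_
  rw [S.mem_act hφ (isSet_upair x y)]
  simp [or_and_right, exists_or]

theorem act_opair (hφ : φ ∈ₘ G) : act φ (opair x y) = opair (act φ x) (act φ y) := by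
  simp only [opair, S.act_upair hφ]

theorem maps_act (hφ : φ ∈ₘ G) : Maps (act φ f) (act φ x) (act φ y) ↔ Maps f x y := by
  rw [maps_iff, maps_iff, ← S.act_opair hφ, S.act_mem_act hφ]

/-! ### Stabilizers and hereditarily symmetric objects -/

omit hM in
theorem filter_subset {K : M} (hK : K ∈ₘ F) (hφ : φ ∈ₘ K) : φ ∈ₘ G :=
  (S.filter.subgroup K hK).1.2.2 φ hφ

theorem fixes_iff {K : M} (hK : K ∈ₘ F) : Fixes K x ↔ ∀ φ, φ ∈ₘ K → act φ x = x :=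
  forall₂_congr fun _ hφ => (S.actsTo_iff (S.filter_subset hK hφ)).trans eq_comm

omit hM in
theorem exists_inter {K L : M} (hK : K ∈ₘ F) (hL : L ∈ₘ F) :
    ∃ J, J ∈ₘ F ∧ IsSubset J K ∧ IsSubset J L := by
  obtain ⟨J, hJ, h⟩ := S.filter.inter K L hK hL
  have hs := fun K hK => (S.filter.subgroup K hK).2.1
  exact ⟨J, hJ, ⟨hs J hJ, hs K hK, fun z hz => ((h z).1 hz).1⟩,
    ⟨hs J hJ, hs L hL, fun z hz => ((h z).1 hz).2⟩⟩

omit S hM in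
theorem _root_.ZFA.Fixes.mono {K L : M} (h : Fixes K x) (hL : IsSubset L K) : Fixes L x :=
  fun φ hφ => h φ (hL.2.2 φ hφ)

/-- By closure of the filter under larger subgroups, `x` is symmetric as soon as some group of the
filter fixes it. -/
theorem isSymmetric_iff : IsSymmetric G F x ↔ ∃ K, K ∈ₘ F ∧ Fixes K x := by
  constructor
  · rintro ⟨H, hH, h⟩
    exact ⟨H, hH, fun φ hφ => ((h φ).1 hφ).2⟩
  · rintro ⟨K, hK, h⟩
    obtain ⟨H, hHs, hH⟩ := exists_sep G fun φ => ActsTo φ x x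
    have hH' : ∀ φ, φ ∈ₘ H ↔ φ ∈ₘ G ∧ act φ x = x := fun φ => by
      rw [hH]
      exact and_congr_right fun hφ => (S.actsTo_iff hφ).trans eq_comm
    obtain ⟨hGs, hGb, ⟨i, hi, hi'⟩, hGc, hGi⟩ := S.group
    refine ⟨H, S.filter.upward K H hK ⟨⟨hHs, hGs, fun φ hφ => ((hH φ).1 hφ).1⟩, hHs,
      fun φ hφ => hGb φ ((hH φ).1 hφ).1, ⟨i, (hH' i).2 ⟨hi, S.act_eq_self hi hi' x⟩, hi'⟩, ?_, ?_⟩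
      ⟨(S.filter.subgroup K hK).2.1, hHs, fun φ hφ => (hH φ).2 ⟨S.filter_subset hK hφ, h φ hφ⟩⟩, hH⟩
    · intro φ ψ hφ hψ
      obtain ⟨hφ, h1⟩ := (hH' φ).1 hφ
      obtain ⟨hψ, h2⟩ := (hH' ψ).1 hψ
      obtain ⟨χ, hχ, h3⟩ := hGc φ ψ hφ hψ
      exact ⟨χ, (hH' χ).2 ⟨hχ, by rw [S.act_comp hφ hψ hχ h3, h2, h1]⟩, h3⟩
    · intro φ hφ
      obtain ⟨hφ, h1⟩ := (hH' φ).1 hφ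
      obtain ⟨ψ, hψ, h2⟩ := hGi φ hφ
      refine ⟨ψ, (hH' ψ).2 ⟨hψ, ?_⟩, h2⟩
      have h3 := S.act_act_of_inverse hφ hψ h2 x
      rwa [h1] at h3

theorem isSymmetric_act (hφ : φ ∈ₘ G) (h : IsSymmetric G F x) : IsSymmetric G F (act φ x) := by
  obtain ⟨H, hH, h⟩ := S.isSymmetric_iff.1 h
  rw [S.fixes_iff hH] at h
  obtain ⟨K, hK, h'⟩ := S.filter.conj φ H hφ hH
  refine S.isSymmetric_iff.2 ⟨K, hK, (S.fixes_iff hK).2 fun χ hχ => ?_⟩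
  obtain ⟨hχ, ψ, hψ, hc⟩ := (h' χ).1 hχ
  have hψG := S.filter_subset hH hψ
  have h1 := (S.perm hφ).defFun_act
  have h2 := (S.perm hψG).defFun_act
  have h3 := (S.perm hχ).defFun_act
  have h4 : DefFun₁ fun x => act φ (act ψ x) := DefFun.subst₁ h1
  have h5 : DefFun₁ fun x => act χ (act φ x) := DefFun.subst₁ h3
  -- `χ = φ ψ φ⁻¹` on the atoms, so `χ φ = φ ψ` everywhere.
  have key := ((S.perm hχ).isHom_act.comp (S.perm hφ).isHom_act).ext
    ((S.perm hφ).isHom_act.comp (S.perm hψG).isHom_act) (fun a ha =>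
      S.act_eq_of_maps hχ ((S.perm hφ).isHom_act.atom a ha) (hc a _ _ _ ((S.perm hφ).maps_act ha)
        ((S.perm hφ).maps_act ((S.perm hψG).isHom_act.atom a ha)) ((S.perm hψG).maps_act ha))) x
  rw [key, h ψ hψ]

omit S hM in
theorem _root_.ZFA.IsHereditarilySymmetric.of_mem (h : IsHereditarilySymmetric G F x)
    (hz : z ∈ₘ x) : IsHereditarilySymmetric G F z := by
  obtain ⟨t, ht, hx, h⟩ := h
  exact ⟨t, ht, ht.2 x hx z hz, h⟩

theorem exists_fixes (h : IsHereditarilySymmetric G F x) : ∃ K, K ∈ₘ F ∧ Fixes K x := by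
  obtain ⟨t, ht, hx, h⟩ := h
  exact S.isSymmetric_iff.1 (h x hx)

/-- A symmetric set of hereditarily symmetric objects is hereditarily symmetric. -/
theorem hereditarilySymmetric_of_fixes (hx : IsSet x)
    (h : ∀ z, z ∈ₘ x → IsHereditarilySymmetric G F z) {K : M} (hK : K ∈ₘ F) (hfix : Fixes K x) :
    IsHereditarilySymmetric G F x := by
  obtain ⟨t₀, ht₀, hxt₀⟩ := exists_transitive x
  obtain ⟨t, hts, ht⟩ := exists_sep t₀ fun z => IsHereditarilySymmetric G F z ∨ z = x
  refine ⟨t, ⟨hts, fun y hy z hz => ?_⟩, (ht x).2 ⟨hxt₀, Or.inr rfl⟩, fun y hy => ?_⟩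
  · obtain ⟨h1, h2⟩ := (ht y).1 hy
    refine (ht z).2 ⟨ht₀.2 y h1 z hz, Or.inl ?_⟩
    rcases h2 with h2 | rfl
    · exact h2.of_mem hz
    · exact h z hz
  · rcases ((ht y).1 hy).2 with ⟨t', -, hy', h'⟩ | rfl
    · exact h' y hy'
    · exact S.isSymmetric_iff.2 ⟨K, hK, hfix⟩

theorem hereditarilySymmetric_act (hφ : φ ∈ₘ G) (h : IsHereditarilySymmetric G F x) :
    IsHereditarilySymmetric G F (act φ x) := by
  obtain ⟨t, ht, hx, h⟩ := h
  refine ⟨act φ t, ⟨S.isSet_act hφ ht.1, fun y hy z hz => ?_⟩, (S.act_mem_act hφ).2 hx,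
    fun y hy => ?_⟩
  · obtain ⟨w, hw, rfl⟩ := (S.mem_act hφ ht.1).1 hy
    have hws : IsSet w := (S.isSet_act_iff hφ).1 (isSet_of_mem hz)
    obtain ⟨u, hu, rfl⟩ := (S.mem_act hφ hws).1 hz
    exact (S.act_mem_act hφ).2 (ht.2 w hw u hu)
  · obtain ⟨w, hw, rfl⟩ := (S.mem_act hφ ht.1).1 hy
    exact S.isSymmetric_act hφ (h w hw)

theorem fixes_of_forall_mem {K : M} (hK : K ∈ₘ F) (hx : IsSet x) (h : ∀ z, z ∈ₘ x → Fixes K z) :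
    Fixes K x := by
  rw [S.fixes_iff hK]
  intro φ hφ
  have hφG := S.filter_subset hK hφ
  have h' : ∀ z, z ∈ₘ x → act φ z = z := fun z hz => (S.fixes_iff hK).1 (h z hz) φ hφ
  refine set_ext (S.isSet_act hφG hx) hx fun z => ?_
  rw [S.mem_act hφG hx]
  constructor
  · rintro ⟨w, hw, rfl⟩
    rwa [h' w hw]
  · exact fun hz => ⟨z, hz, (h' z hz).symm⟩

/-- A group fixes a set as soon as each of its elements maps the set into itself, since the inverses
of these elements do so too. -/
theorem fixes_of_act_mem {K : M} (hK : K ∈ₘ F) (hx : IsSet x)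
    (h : ∀ φ, φ ∈ₘ K → ∀ z, z ∈ₘ x → act φ z ∈ₘ x) : Fixes K x := by
  rw [S.fixes_iff hK]
  intro φ hφ
  have hφG := S.filter_subset hK hφ
  refine set_ext (S.isSet_act hφG hx) hx fun z => ?_
  rw [S.mem_act hφG hx]
  constructor
  · rintro ⟨w, hw, rfl⟩
    exact h φ hφ w hw
  · intro hz
    obtain ⟨ψ, hψ, h1⟩ := (S.filter.subgroup K hK).2.2.2.2.2 φ hφ
    obtain ⟨χ, hχ, h2⟩ := (S.filter.subgroup K hK).2.2.2.2.2 ψ hψ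
    have hψG := S.filter_subset hK hψ
    refine ⟨act ψ z, h ψ hψ z hz, ?_⟩
    rw [← S.act_inj hψG, S.act_act_of_inverse hφG hψG h1]

theorem fixes_opair {K : M} (hK : K ∈ₘ F) (hx : Fixes K x) (hy : Fixes K y) :
    Fixes K (opair x y) := by
  rw [S.fixes_iff hK] at *
  intro φ hφ
  rw [S.act_opair (S.filter_subset hK hφ), hx φ hφ, hy φ hφ]

theorem fixes_of_maps {K X : M} (hK : K ∈ₘ F) (hf : IsFunOn f X) (hff : Fixes K f)
    (hx : Fixes K x) (h : Maps f x y) : Fixes K y := by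
  rw [S.fixes_iff hK] at *
  intro φ hφ
  have h1 := (S.maps_act (S.filter_subset hK hφ)).2 h
  rw [hff φ hφ, hx φ hφ] at h1
  exact hf.eq_of_maps h1 h

theorem fixes_of_maps_inj {K X Y : M} (hK : K ∈ₘ F) (hf : IsInj f X Y) (hff : Fixes K f)
    (hy : Fixes K y) (h : Maps f x y) : Fixes K x := by
  rw [S.fixes_iff hK] at *
  intro φ hφ
  have h1 := (S.maps_act (S.filter_subset hK hφ)).2 h
  rw [hff φ hφ, hy φ hφ] at h1
  exact hf.2 _ _ _ h1 h

theorem fixes_fun {K X : M} (hK : K ∈ₘ F) (hf : IsFunOn f X)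
    (h : ∀ x y, Maps f x y → Fixes K x ∧ Fixes K y) : Fixes K f := by
  refine S.fixes_of_forall_mem hK hf.1 fun p hp => ?_
  obtain ⟨x, y, rfl, hxy⟩ := hf.eq_opair hp
  exact S.fixes_opair hK (h x y hxy).1 (h x y hxy).2

theorem hereditarilySymmetric_opair (hx : IsHereditarilySymmetric G F x)
    (hy : IsHereditarilySymmetric G F y) : IsHereditarilySymmetric G F (opair x y) := by
  have key : ∀ x y, IsHereditarilySymmetric G F x → IsHereditarilySymmetric G F y →
      IsHereditarilySymmetric G F (upair x y) := by
    intro x y hx hy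
    obtain ⟨K, hK, hKx⟩ := S.exists_fixes hx
    obtain ⟨L, hL, hLy⟩ := S.exists_fixes hy
    obtain ⟨J, hJ, hJK, hJL⟩ := S.exists_inter hK hL
    refine S.hereditarilySymmetric_of_fixes (isSet_upair x y) (fun z hz => ?_) hJ
      (S.fixes_of_forall_mem hJ (isSet_upair x y) fun z hz => ?_)
    · rcases mem_upair.1 hz with rfl | rfl <;> assumption
    · rcases mem_upair.1 hz with rfl | rfl
      · exact hKx.mono hJK
      · exact hLy.mono hJL
  exact key _ _ (key _ _ hx hx) (key _ _ hx hy)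

theorem hereditarilySymmetric_fun {K X : M} (hK : K ∈ₘ F) (hf : IsFunOn f X)
    (h : ∀ x y, Maps f x y → IsHereditarilySymmetric G F x ∧ IsHereditarilySymmetric G F y)
    (hfix : Fixes K f) : IsHereditarilySymmetric G F f := by
  refine S.hereditarilySymmetric_of_fixes hf.1 (fun p hp => ?_) hK hfix
  obtain ⟨x, y, rfl, hxy⟩ := hf.eq_opair hp
  exact S.hereditarilySymmetric_opair (h x y hxy).1 (h x y hxy).2

theorem symmetric_of_mem_omega :
    ∀ n, n ∈ₘ omega M → Fixes G n ∧ IsHereditarilySymmetric G F n := by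
  have hG := S.filter.top_mem
  apply omega_induction
  · have h := S.fixes_of_forall_mem hG (isSet_empty (M := M)) fun z hz => absurd hz not_mem_empty
    exact ⟨h, S.hereditarilySymmetric_of_fixes isSet_empty (fun z hz => absurd hz not_mem_empty)
      hG h⟩
  · rintro n - ⟨h1, h2⟩
    -- `n` is fixed as a set by every element of `G`, though its elements are not known to be.
    have h := S.fixes_of_act_mem hG (isSet_succ n) fun φ hφ z hz => by
      have h3 := (S.fixes_iff hG).1 h1 φ hφ
      rcases mem_succ.1 hz with hz | rfl
      · exact mem_succ.2 (Or.inl (h3 ▸ (S.act_mem_act hφ).2 hz))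
      · exact mem_succ.2 (Or.inr h3)
    refine ⟨h, S.hereditarilySymmetric_of_fixes (isSet_succ n) (fun z hz => ?_) hG h⟩
    rcases mem_succ.1 hz with hz | rfl
    · exact h2.of_mem hz
    · exact h2

theorem fixes_nat {K n : M} (hK : K ∈ₘ F) (hn : n ∈ₘ omega M) : Fixes K n :=
  (S.symmetric_of_mem_omega n hn).1.mono (S.filter.subgroup K hK).1

theorem hereditarilySymmetric_omega : IsHereditarilySymmetric G F (omega M) :=
  S.hereditarilySymmetric_of_fixes isSet_omega (fun n hn => (S.symmetric_of_mem_omega n hn).2)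
    S.filter.top_mem (S.fixes_of_forall_mem S.filter.top_mem isSet_omega
      fun n hn => (S.symmetric_of_mem_omega n hn).1)

end PermSystem

end System

/-! ### Absoluteness for the permutation model -/

section PermModel

variable {M : Type*} [SetStr M] [hM : Fact (IsModelZFAC M)]

namespace PermSystem

variable {A G F : M} (S : PermSystem A G F)

omit hM in
theorem forall_mem_permModel {x : PermModel G F} {P : M → Prop} :
    (∀ z : PermModel G F, z ∈ₘ x → P z.1) ↔ ∀ z, z ∈ₘ x.1 → P z :=
  ⟨fun h z hz => h ⟨z, x.2.of_mem hz⟩ hz, fun h z hz => h z.1 hz⟩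

omit hM in
theorem exists_mem_permModel {x : PermModel G F} {P : M → Prop} :
    (∃ z : PermModel G F, z ∈ₘ x ∧ P z.1) ↔ ∃ z, z ∈ₘ x.1 ∧ P z :=
  ⟨fun ⟨z, hz, h⟩ => ⟨z.1, hz, h⟩, fun ⟨z, hz, h⟩ => ⟨⟨z, x.2.of_mem hz⟩, hz, h⟩⟩

omit hM in
theorem isSubset_permModel {x y : PermModel G F} : IsSubset x y ↔ IsSubset x.1 y.1 :=
  and_congr_right fun _ => and_congr_right fun _ => forall_mem_permModel (P := fun z => z ∈ₘ y.1)

omit hM in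
theorem isNonemptySet_permModel {x : PermModel G F} : IsNonemptySet x ↔ IsNonemptySet x.1 :=
  and_congr_right fun _ => ⟨fun ⟨z, hz⟩ => ⟨z.1, hz⟩, fun ⟨z, hz⟩ => ⟨⟨z, x.2.of_mem hz⟩, hz⟩⟩

theorem isUPair_permModel {p x y : PermModel G F} :
    IsUPair p x y ↔ p.1 = upair x.1 y.1 := by
  rw [← isUPair_iff]
  refine and_congr_right fun _ => ⟨fun h z => ⟨fun hz => ?_, ?_⟩, fun h z => ?_⟩
  · exact ((h ⟨z, p.2.of_mem hz⟩).1 hz).imp (congrArg Subtype.val) (congrArg Subtype.val)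
  · rintro (rfl | rfl)
    · exact (h x).2 (Or.inl rfl)
    · exact (h y).2 (Or.inr rfl)
  · exact (h z.1).trans (or_congr Subtype.ext_iff.symm Subtype.ext_iff.symm)

theorem isOPair_permModel {p x y : PermModel G F} : IsOPair p x y ↔ p.1 = opair x.1 y.1 := by
  simp only [IsOPair, isUPair_permModel]
  constructor
  · rintro ⟨s, d, hs, hd, hp⟩
    rw [hp, hs, hd, opair]
  · intro hp
    have hs : upair x.1 x.1 ∈ₘ p.1 := by rw [hp, opair]; simp
    have hd : upair x.1 y.1 ∈ₘ p.1 := by rw [hp, opair]; simp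
    exact ⟨⟨_, p.2.of_mem hs⟩, ⟨_, p.2.of_mem hd⟩, rfl, rfl, hp⟩

theorem maps_permModel {f x y : PermModel G F} : Maps f x y ↔ Maps f.1 x.1 y.1 := by
  simp only [Maps, isOPair_permModel, isOPair_iff]
  exact exists_mem_permModel (P := fun p => p = opair x.1 y.1)

omit hM in
theorem _root_.ZFA.IsHereditarilySymmetric.of_opair {p x y : M}
    (hp : IsHereditarilySymmetric G F p) (h : IsOPair p x y) :
    IsHereditarilySymmetric G F x ∧ IsHereditarilySymmetric G F y := by
  obtain ⟨s, d, hs, hd, hp'⟩ := h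
  have h2 : IsHereditarilySymmetric G F d := hp.of_mem ((hp'.2 d).2 (Or.inr rfl))
  exact ⟨h2.of_mem ((hd.2 x).2 (Or.inl rfl)), h2.of_mem ((hd.2 y).2 (Or.inr rfl))⟩

omit hM in
theorem _root_.ZFA.IsHereditarilySymmetric.of_maps {f x y : M}
    (hf : IsHereditarilySymmetric G F f) (h : Maps f x y) :
    IsHereditarilySymmetric G F x ∧ IsHereditarilySymmetric G F y := by
  obtain ⟨p, hp, h⟩ := h
  exact (hf.of_mem hp).of_opair h

theorem isFunOn_permModel {f X : PermModel G F} : IsFunOn f X ↔ IsFunOn f.1 X.1 := by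
  refine and_congr_right fun _ => and_congr_right fun _ => and_congr ?_ ?_
  · rw [← forall_mem_permModel]
    refine forall₂_congr fun p _ => ?_
    rw [← exists_mem_permModel]
    refine exists_congr fun x => and_congr_right fun _ => ?_
    simp only [isOPair_permModel, isOPair_iff]
    exact ⟨fun ⟨y, h⟩ => ⟨y.1, h⟩, fun ⟨y, h⟩ => ⟨⟨y, (p.2.of_opair (isOPair_iff.2 h)).2⟩, h⟩⟩
  · rw [← forall_mem_permModel]
    refine forall₂_congr fun x _ => ?_
    simp only [maps_permModel]
    constructor
    · rintro ⟨y, hy, hu⟩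
      exact ⟨y.1, hy, fun z hz => congrArg Subtype.val (hu ⟨z, (f.2.of_maps hz).2⟩ hz)⟩
    · rintro ⟨y, hy, hu⟩
      exact ⟨⟨y, (f.2.of_maps hy).2⟩, hy, fun z hz => Subtype.ext (hu z.1 hz)⟩

theorem isFun_permModel {f X Y : PermModel G F} : IsFun f X Y ↔ IsFun f.1 X.1 Y.1 := by
  refine and_congr isFunOn_permModel (and_congr_right fun _ => ?_)
  simp only [maps_permModel]
  exact ⟨fun h x y hxy => h ⟨x, (f.2.of_maps hxy).1⟩ ⟨y, (f.2.of_maps hxy).2⟩ hxy,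
    fun h x y hxy => h x.1 y.1 hxy⟩

theorem isInj_permModel {f X Y : PermModel G F} : IsInj f X Y ↔ IsInj f.1 X.1 Y.1 := by
  refine and_congr isFun_permModel ?_
  simp only [maps_permModel]
  exact ⟨fun h x x' y hx hx' => congrArg Subtype.val (h ⟨x, (f.2.of_maps hx).1⟩
    ⟨x', (f.2.of_maps hx').1⟩ ⟨y, (f.2.of_maps hx).2⟩ hx hx'),
    fun h x x' y hx hx' => Subtype.ext (h x.1 x'.1 y.1 hx hx')⟩

theorem isChoiceFun_permModel {f R : PermModel G F} : IsChoiceFun f R ↔ IsChoiceFun f.1 R.1 := by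
  refine and_congr isFunOn_permModel ?_
  simp only [maps_permModel]
  exact ⟨fun h x y hxy => h ⟨x, (f.2.of_maps hxy).1⟩ ⟨y, (f.2.of_maps hxy).2⟩ hxy,
    fun h x y hxy => h x.1 y.1 hxy⟩

include S

theorem isInductive_permModel {w : PermModel G F} : IsInductive w ↔ IsInductive w.1 := by
  rw [isInductive_iff (w := w.1)]
  have he := (S.symmetric_of_mem_omega _ empty_mem_omega).2
  have hempty : ∀ e : PermModel G F, IsEmptySet e ↔ e.1 = empty M := by
    intro e
    rw [← isEmptySet_iff]
    exact and_congr_right fun _ =>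
      ⟨fun h z hz => h ⟨z, e.2.of_mem hz⟩ hz, fun h z hz => h z.1 hz⟩
  have hsucc : ∀ s n : PermModel G F, IsSucc s n ↔ s.1 = succ n.1 := by
    intro s n
    rw [← isSucc_iff]
    refine and_congr_right fun _ => ⟨fun h z => ⟨fun hz => ?_, ?_⟩, fun h z => ?_⟩
    · exact ((h ⟨z, s.2.of_mem hz⟩).1 hz).imp id (congrArg Subtype.val)
    · rintro (hz | rfl)
      · exact (h ⟨z, n.2.of_mem hz⟩).2 (Or.inl hz)
      · exact (h n).2 (Or.inr rfl)
    · exact (h z.1).trans (or_congr Iff.rfl Subtype.ext_iff.symm)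
  refine and_congr_right fun _ => and_congr ?_ ?_
  · simp only [hempty]
    exact ⟨fun ⟨e, h, h'⟩ => h ▸ h', fun h => ⟨⟨_, he⟩, rfl, h⟩⟩
  · simp only [hsucc]
    rw [← forall_mem_permModel]
    exact forall₂_congr fun n _ => ⟨fun ⟨s, h, h'⟩ => h ▸ h',
      fun h => ⟨⟨_, w.2.of_mem h⟩, rfl, h⟩⟩

theorem isOmega_permModel {w : PermModel G F} : IsOmega w ↔ w.1 = omega M := by
  rw [IsOmega]
  simp only [S.isInductive_permModel, isSubset_permModel]
  constructor
  · rintro ⟨h1, h2⟩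
    exact set_ext h1.1 isSet_omega fun z =>
      ⟨(h2 ⟨_, S.hereditarilySymmetric_omega⟩ isOmega_omega.1).2.2 z,
        (isOmega_omega.2 _ h1).2.2 z⟩
  · intro h
    rw [h]
    exact ⟨isOmega_omega.1, fun v hv => isOmega_omega.2 v.1 hv⟩

theorem isCountableSet_permModel {x : PermModel G F} :
    IsCountableSet x ↔ ∃ f, IsHereditarilySymmetric G F f ∧ IsInj f x.1 (omega M) := by
  simp only [IsCountableSet, S.isOmega_permModel, isInj_permModel]
  constructor
  · rintro ⟨w, hw, f, hf⟩
    exact ⟨f.1, f.2, hw ▸ hf⟩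
  · rintro ⟨f, hf, h⟩
    exact ⟨⟨_, S.hereditarilySymmetric_omega⟩, rfl, ⟨f, hf⟩, h⟩

theorem isCountableSet_of_permModel {x : PermModel G F} (h : IsCountableSet x) :
    IsCountableSet x.1 := by
  obtain ⟨f, -, h⟩ := S.isCountableSet_permModel.1 h
  exact isCountableSet_iff.2 ⟨f, h⟩

/-- A set that is countable in `M` and has all its elements fixed by one group of the filter is
countable in the permutation model: that group fixes every enumeration of it. -/
theorem isCountableSet_permModel_of_fixes {x : PermModel G F} (h : IsCountableSet x.1) {K : M}
    (hK : K ∈ₘ F) (hfix : ∀ z, z ∈ₘ x.1 → Fixes K z) : IsCountableSet x := by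
  obtain ⟨f, hf⟩ := isCountableSet_iff.1 h
  refine S.isCountableSet_permModel.2 ⟨f, S.hereditarilySymmetric_fun hK hf.1.1 (fun z n hzn =>
    ⟨x.2.of_mem (hf.1.1.mem_dom hzn), (S.symmetric_of_mem_omega n (hf.1.2.2 z n hzn)).2⟩)
    (S.fixes_fun hK hf.1.1 fun z n hzn =>
    ⟨hfix z (hf.1.1.mem_dom hzn), S.fixes_nat hK (hf.1.2.2 z n hzn)⟩), hf⟩

/-- A group that fixes an enumeration fixes everything enumerated. -/
theorem fixes_mem_of_isInj {K f x : M} (hK : K ∈ₘ F) (hf : IsInj f x (omega M))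
    (hfix : Fixes K f) {z : M} (hz : z ∈ₘ x) : Fixes K z := by
  obtain ⟨n, hn⟩ := hf.1.1.exists_maps hz
  exact S.fixes_of_maps_inj hK hf hfix (S.fixes_nat hK (hf.1.2.2 z n hn)) hn

theorem isCountableHitting_permModel {x a X : PermModel G F} :
    IsCountableHitting x a X ↔ IsSubset x.1 X.1 ∧
      (∃ f, IsHereditarilySymmetric G F f ∧ IsInj f x.1 (omega M)) ∧
      ∀ z, z ∈ₘ a.1 → ∃ u, u ∈ₘ x.1 ∧ u ∈ₘ z := by
  refine and_congr isSubset_permModel (and_congr S.isCountableSet_permModel ?_)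
  rw [← forall_mem_permModel]
  exact forall₂_congr fun z _ => exists_mem_permModel (P := fun u => u ∈ₘ z.1)

/-! ### Saturation under orbits -/

theorem exists_comp {φ ψ : M} (hφ : φ ∈ₘ G) (hψ : ψ ∈ₘ G) :
    ∃ χ, χ ∈ₘ G ∧ ∀ x, act χ x = act φ (act ψ x) := by
  obtain ⟨χ, hχ, h⟩ := S.group.2.2.2.1 φ ψ hφ hψ
  exact ⟨χ, hχ, S.act_comp hφ hψ hχ h⟩

theorem exists_actsTo_self (x : M) : ∃ φ, φ ∈ₘ G ∧ ActsTo φ x x := by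
  obtain ⟨i, hi, hi'⟩ := S.group.2.2.1
  exact ⟨i, hi, (S.actsTo_iff hi).2 (S.act_eq_self hi hi' x).symm⟩

/-- If `K` fixes `X`, then it fixes every union of traces on `X` of full `G`-orbits. -/
theorem fixes_saturation {K X c d : M} (hK : K ∈ₘ F) (hX : Fixes K X) (hd : IsSet d)
    (h : ∀ x, x ∈ₘ d ↔ x ∈ₘ X ∧ ∃ u, u ∈ₘ c ∧ ∃ φ, φ ∈ₘ G ∧ ActsTo φ u x) : Fixes K d := by
  refine S.fixes_of_act_mem hK hd fun φ hφ z hz => ?_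
  have hφG := S.filter_subset hK hφ
  obtain ⟨h1, u, hu, ψ, hψ, h2⟩ := (h z).1 hz
  obtain ⟨χ, hχ, h3⟩ := S.exists_comp hφG hψ
  refine (h _).2 ⟨?_, u, hu, χ, hχ, ?_⟩
  · rw [← (S.fixes_iff hK).1 hX φ hφ]
    exact (S.act_mem_act hφG).2 h1
  · rw [S.actsTo_iff hχ, h3, ← (S.actsTo_iff hψ).1 h2]

theorem psZeroII {B : M} (hB : IsFilterBase B F)
    (ha : ∀ x : PermModel G F, ∀ H : M, H ∈ₘ B → ∀ φ : M, φ ∈ₘ G →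
      Fixes H x.1 → ∀ y : M, ActsTo φ x.1 y → Fixes H y)
    (hb : ∀ x : PermModel G F, ∃ O : PermModel G F, IsOrbit O.1 G x.1 ∧ IsCountableSet O) :
    PSZeroII (PermModel G F) := by
  intro X w s hX _ hw hs _ hC
  obtain ⟨Z, -, hZ⟩ := hM.out.powerset X.1 hX
  have hw' := S.isOmega_permModel.1 hw
  have hs' := isFunOn_permModel.1 hs
  rw [hw'] at hs'
  -- In `M`, choose a countable hitting set for each term of the sequence.
  obtain ⟨c, hc, hc'⟩ := exists_choice (omega M) Z isSet_omega
    (fun n x => IsHereditarilySymmetric G F x ∧ ∃ a, Maps s.1 n a ∧ IsSubset x X.1 ∧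
      (∃ f, IsHereditarilySymmetric G F f ∧ IsInj f x (omega M)) ∧
      ∀ z, z ∈ₘ a → ∃ u, u ∈ₘ x ∧ u ∈ₘ z) (by
    intro n hn
    obtain ⟨a, hna⟩ := hs'.exists_maps hn
    obtain ⟨h1, h2⟩ := s.2.of_maps hna
    obtain ⟨x, hx⟩ := hC ⟨n, h1⟩ ⟨a, h2⟩ (maps_permModel.2 hna)
    have hx' := S.isCountableHitting_permModel.1 hx
    exact ⟨x.1, (hZ _).2 hx'.1, x.2, a, hna, hx'⟩)
  -- Replace each chosen set by its saturation under the orbits of `G`, inside `X`.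
  obtain ⟨f, hf, hf'⟩ := exists_fun (omega M) isSet_omega
    (fun n d => ∃ v, Maps c n v ∧ IsSet d ∧
      ∀ x, x ∈ₘ d ↔ x ∈ₘ X.1 ∧ ∃ u, u ∈ₘ v ∧ ∃ φ, φ ∈ₘ G ∧ ActsTo φ u x) (by
    intro n hn
    obtain ⟨v, hv⟩ := hc.exists_maps hn
    obtain ⟨d, hd, h⟩ := exists_sep X.1 fun x => ∃ u, u ∈ₘ v ∧ ∃ φ, φ ∈ₘ G ∧ ActsTo φ u x
    refine ⟨d, ⟨v, hv, hd, h⟩, ?_⟩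
    rintro d' ⟨v', hv', hd', h'⟩
    obtain rfl := hc.eq_of_maps hv hv'
    exact set_ext hd' hd fun x => by rw [h, h'])
  obtain ⟨K, hK, hKX⟩ := S.exists_fixes X.2
  have hfK : ∀ n d, Maps f n d → Fixes K d := by
    intro n d hnd
    obtain ⟨-, v, -, hd, h⟩ := (hf' n d).1 hnd
    exact S.fixes_saturation hK hKX hd h
  have hfN : ∀ n d, Maps f n d → IsHereditarilySymmetric G F d := by
    intro n d hnd
    obtain ⟨-, v, -, hd, h⟩ := (hf' n d).1 hnd
    exact S.hereditarilySymmetric_of_fixes hd (fun z hz => X.2.of_mem ((h z).1 hz).1) hK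
      (hfK n d hnd)
  have hf2 : IsHereditarilySymmetric G F f :=
    S.hereditarilySymmetric_fun hK hf
      (fun n d hnd => ⟨(S.symmetric_of_mem_omega n (hf.mem_dom hnd)).2, hfN n d hnd⟩)
      (S.fixes_fun hK hf fun n d hnd => ⟨S.fixes_nat hK (hf.mem_dom hnd), hfK n d hnd⟩)
  refine ⟨⟨f, hf2⟩, isFunOn_permModel.2 (by rw [hw']; exact hf), fun n a d hna hnd => ?_⟩
  replace hna := maps_permModel.1 hna
  replace hnd : Maps f n.1 d.1 := maps_permModel.1 hnd
  obtain ⟨hn, v, hv, hd, h⟩ := (hf' _ _).1 hnd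
  obtain ⟨-, hvN, a', hna', hvX, ⟨g, hgN, hg⟩, hhit⟩ := hc' _ _ hv
  obtain rfl := hs'.eq_of_maps hna hna'
  have hvd : ∀ u, u ∈ₘ v → u ∈ₘ d.1 := fun u hu =>
    (h u).2 ⟨hvX.2.2 u hu, u, hu, S.exists_actsTo_self u⟩
  refine ⟨isSubset_permModel.2 ⟨hd, hX, fun x hx => ((h x).1 hx).1⟩, ?_,
    ?_⟩
  · -- A group of the base that fixes an enumeration of `v` fixes all elements of `d`.
    obtain ⟨L, hL, hLg⟩ := S.exists_fixes hgN
    obtain ⟨H, hH, hHL⟩ := hB.2.2 L hL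
    have hHF := hB.2.1 H hH
    refine S.isCountableSet_permModel_of_fixes ?_ hHF fun x hx => ?_
    · refine isCountableSet_iUnion (isCountableSet_iff.2 ⟨g, hg⟩) d.1 hd
        (fun u x => ∃ φ, φ ∈ₘ G ∧ ActsTo φ u x) (fun x hx => ((h x).1 hx).2) ?_
      intro u hu t ht ht'
      obtain ⟨O, hO, hOc⟩ := hb ⟨u, hvN.of_mem hu⟩
      exact (S.isCountableSet_of_permModel hOc).of_rel t ht (fun x y => x = y)
        (fun y hy => ⟨y, (hO.2 y).2 ((ht' y).1 hy).2, rfl⟩) fun x y y' _ _ _ h h' => h ▸ h'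
    · obtain ⟨-, u, hu, φ, hφ, h1⟩ := (h x).1 hx
      exact ha ⟨u, hvN.of_mem hu⟩ H hH φ hφ
        (S.fixes_mem_of_isInj hHF hg (hLg.mono hHL) hu) x h1
  · intro z hz
    obtain ⟨u, hu, huz⟩ := hhit z.1 hz
    exact ⟨⟨u, hvN.of_mem hu⟩, hvd u hu, huz⟩

theorem cacTransfer {B : M} (hB : IsFilterBase B F)
    (ha : ∀ x : PermModel G F, ∀ H : M, H ∈ₘ B → ∀ φ : M, φ ∈ₘ G →
      Fixes H x.1 → ∀ y : M, ActsTo φ x.1 y → Fixes H y) :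
    CACTransfer (PermModel G F) := by
  intro X hX hC
  obtain ⟨K, hK, hKX⟩ := S.exists_fixes X.2
  obtain ⟨Z, hZ⟩ := exists_bound_fun (omega M) X.1
  obtain ⟨P, hPs, hP⟩ := exists_sep Z
    fun f => IsHereditarilySymmetric G F f ∧ IsFun f (omega M) X.1
  have hP' : ∀ f, f ∈ₘ P ↔ IsHereditarilySymmetric G F f ∧ IsFun f (omega M) X.1 := fun f =>
    (hP f).trans (and_iff_right_of_imp fun h => hZ f h.2)
  have hPN : IsHereditarilySymmetric G F P := by
    refine S.hereditarilySymmetric_of_fixes hPs (fun f hf => ((hP' f).1 hf).1) hK ?_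
    refine S.fixes_of_act_mem hK hPs fun φ hφ f hf => ?_
    have hφG := S.filter_subset hK hφ
    obtain ⟨h1, h2⟩ := (hP' f).1 hf
    refine (hP' _).2 ⟨S.hereditarilySymmetric_act hφG h1, ?_⟩
    have hmaps : ∀ n y, n ∈ₘ omega M → (Maps (act φ f) n (act φ y) ↔ Maps f n y) := by
      intro n y hn
      rw [← S.maps_act hφG (f := f), (S.fixes_iff hK).1 (S.fixes_nat hK hn) φ hφ]
    have hX' : ∀ y, act φ y ∈ₘ X.1 ↔ y ∈ₘ X.1 := by
      intro y
      rw [← S.act_mem_act hφG (z := y), (S.fixes_iff hK).1 hKX φ hφ]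
    obtain ⟨ψ, -, -, hψ⟩ := S.exists_inv hφG
    have hdom : ∀ n y, Maps (act φ f) n y → n ∈ₘ omega M := by
      intro n y hny
      rw [maps_iff, S.mem_act hφG h2.1.1] at hny
      obtain ⟨p, hp, h⟩ := hny
      obtain ⟨m, z, rfl, hmz⟩ := h2.1.eq_opair hp
      have hm := h2.1.mem_dom hmz
      rw [S.act_opair hφG, (S.fixes_iff hK).1 (S.fixes_nat hK hm) φ hφ, opair_inj] at h
      exact h.1 ▸ hm
    refine ⟨⟨S.isSet_act hφG h2.1.1, isSet_omega, ?_, ?_⟩, hX, ?_⟩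
    · intro p hp
      obtain ⟨q, hq, rfl⟩ := (S.mem_act hφG h2.1.1).1 hp
      obtain ⟨m, z, rfl, hmz⟩ := h2.1.eq_opair hq
      have hm := h2.1.mem_dom hmz
      refine ⟨m, hm, act φ z, isOPair_iff.2 ?_⟩
      rw [S.act_opair hφG, (S.fixes_iff hK).1 (S.fixes_nat hK hm) φ hφ]
    · intro n hn
      obtain ⟨y, hy⟩ := h2.1.exists_maps hn
      refine ⟨act φ y, (hmaps n y hn).2 hy, fun z hz => ?_⟩
      rw [← hψ z] at hz ⊢
      rw [h2.1.eq_of_maps ((hmaps n _ hn).1 hz) hy]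
    · intro n y hny
      have hn := hdom n y hny
      rw [← hψ y] at hny ⊢
      exact (hX' _).2 (h2.2.2 _ _ ((hmaps n _ hn).1 hny))
  refine ⟨⟨_, S.hereditarilySymmetric_omega⟩, ⟨P, hPN⟩, S.isOmega_permModel.2 rfl,
    ⟨hPs, fun f => ?_⟩, ?_⟩
  · exact ((hP' f.1).trans (and_iff_right f.2)).trans
      (isFun_permModel (f := f) (X := ⟨_, S.hereditarilySymmetric_omega⟩) (Y := X)).symm
  intro R hR hRP
  have hRP' : ∀ r, r ∈ₘ R.1 → IsSubset r P ∧ IsNonemptySet r := by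
    intro r hr
    obtain ⟨h1, h2⟩ := hRP ⟨r, R.2.of_mem hr⟩ hr
    exact ⟨isSubset_permModel.1 h1, isNonemptySet_permModel.1 h2⟩
  obtain ⟨i, hiN, hi⟩ := S.isCountableSet_permModel.1 hR
  -- A choice function in `M`; the rest of the proof shows that it is symmetric.
  obtain ⟨c, hc, hcmem⟩ := hM.out.choice R.1 hi.1.1.2.1 fun r hr => (hRP' r hr).2
  have hcfun : ∀ r f, Maps c r f → IsHereditarilySymmetric G F f ∧ IsFun f (omega M) X.1 :=
    fun r f hrf => (hP' f).1 ((hRP' r (hc.mem_dom hrf)).1.2.2 f (hcmem r f hrf))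
  obtain ⟨U, hUs, hU⟩ := exists_sep X.1 fun u => ∃ r, r ∈ₘ R.1 ∧ ∃ f n, Maps c r f ∧ Maps f n u
  have hUc : IsCountableSet U := by
    refine isCountableSet_iUnion (isCountableSet_iff.2 ⟨i, hi⟩) U hUs
      (fun r u => ∃ f n, Maps c r f ∧ Maps f n u) (fun u hu => ((hU u).1 hu).2) ?_
    intro r hr t ht ht'
    obtain ⟨f, hrf⟩ := hc.exists_maps hr
    have hf := (hcfun r f hrf).2.1
    refine isCountableSet_of_rel t ht (fun n y => Maps f n y) (fun y hy => ?_)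
      fun n y y' _ _ _ => hf.eq_of_maps
    obtain ⟨-, f', n, hrf', hny⟩ := (ht' y).1 hy
    obtain rfl := hc.eq_of_maps hrf hrf'
    exact ⟨n, hf.mem_dom hny, hny⟩
  -- The family of the traces on `X` of the orbits of the values of the chosen sequences.
  obtain ⟨Q, hQs, hQ⟩ := exists_replacement U (fun u o => IsSet o ∧
    ∀ x, x ∈ₘ o ↔ x ∈ₘ X.1 ∧ ∃ v, v ∈ₘ upair u u ∧ ∃ φ, φ ∈ₘ G ∧ ActsTo φ v x)
    fun u _ o o' h h' => set_ext h.1 h'.1 fun x => by rw [h.2, h'.2]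
  have hQK : ∀ o, o ∈ₘ Q → Fixes K o := by
    intro o ho
    obtain ⟨u, -, hos, h⟩ := (hQ o).1 ho
    exact S.fixes_saturation hK hKX hos h
  have hQX : ∀ o, o ∈ₘ Q → IsSubset o X.1 := by
    intro o ho
    obtain ⟨u, -, hos, h⟩ := (hQ o).1 ho
    exact ⟨hos, hX, fun x hx => ((h x).1 hx).1⟩
  have hQN : IsHereditarilySymmetric G F Q :=
    S.hereditarilySymmetric_of_fixes hQs (fun o ho =>
      S.hereditarilySymmetric_of_fixes (hQX o ho).1
        (fun x hx => X.2.of_mem ((hQX o ho).2.2 x hx)) hK (hQK o ho)) hK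
      (S.fixes_of_forall_mem hK hQs hQK)
  have hQc : IsCountableSet Q := hUc.of_rel Q hQs (fun u o => IsSet o ∧
    ∀ x, x ∈ₘ o ↔ x ∈ₘ X.1 ∧ ∃ v, v ∈ₘ upair u u ∧ ∃ φ, φ ∈ₘ G ∧ ActsTo φ v x)
    (fun o ho => (hQ o).1 ho)
    fun u o o' _ _ _ h h' => set_ext h.1 h'.1 fun x => by rw [h.2, h'.2]
  obtain ⟨e, he⟩ := hC ⟨Q, hQN⟩ (S.isCountableSet_permModel_of_fixes hQc hK hQK) fun o ho => by
    refine ⟨isSubset_permModel.2 (hQX o.1 ho), isNonemptySet_permModel.2 ?_⟩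
    obtain ⟨u, hu, hos, h⟩ := (hQ o.1).1 ho
    exact ⟨hos, u, (h u).2 ⟨((hU u).1 hu).1, u, by simp, S.exists_actsTo_self u⟩⟩
  obtain ⟨he, hemem⟩ := isChoiceFun_permModel.1 he
  -- A group `H` of the base that fixes the choice function `e` and the set `X` fixes the values of
  -- `e`, hence everything in their orbits.
  obtain ⟨L, hL, hLe⟩ := S.exists_fixes e.2
  obtain ⟨J, hJ, hJK, hJL⟩ := S.exists_inter hK hL
  obtain ⟨H, hH, hHJ⟩ := hB.2.2 J hJ
  have hHF := hB.2.1 H hH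
  have hHU : ∀ u, u ∈ₘ U → Fixes H u := by
    intro u hu
    obtain ⟨o, hos, ho⟩ := exists_sep X.1
      fun x => ∃ v, v ∈ₘ upair u u ∧ ∃ φ, φ ∈ₘ G ∧ ActsTo φ v x
    have hoQ : o ∈ₘ Q := (hQ o).2 ⟨u, hu, hos, ho⟩
    obtain ⟨x, hox⟩ := he.exists_maps hoQ
    have hHx : Fixes H x := S.fixes_of_maps hHF he ((hLe.mono hJL).mono hHJ)
      (((hQK o hoQ).mono hJK).mono hHJ) hox
    obtain ⟨hxX, v, hv, φ, hφ, hvx⟩ := (ho x).1 (hemem o x hox)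
    obtain rfl : v = u := by simpa using hv
    obtain ⟨ψ, hψ, h1, -⟩ := S.exists_inv hφ
    refine ha ⟨x, X.2.of_mem hxX⟩ H hH ψ hψ hHx v ?_
    exact (S.actsTo_iff hψ).2 (by simp only [(S.actsTo_iff hφ).1 hvx, h1])
  have hHc : ∀ r f, Maps c r f → Fixes H f := by
    intro r f hrf
    have hf := (hcfun r f hrf).2
    refine S.fixes_fun hHF hf.1 fun n u hnu =>
      ⟨S.fixes_nat hHF (hf.1.mem_dom hnu), hHU u ((hU u).2 ⟨hf.2.2 n u hnu, r, hc.mem_dom hrf,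
        f, n, hrf, hnu⟩)⟩
  obtain ⟨I, hI, hIi⟩ := S.exists_fixes hiN
  obtain ⟨D, hD, hDH, hDI⟩ := S.exists_inter hHF hI
  have hcN : IsHereditarilySymmetric G F c :=
    S.hereditarilySymmetric_fun hD hc
      (fun r f hrf => ⟨R.2.of_mem (hc.mem_dom hrf), (hcfun r f hrf).1⟩)
      (S.fixes_fun hD hc fun r f hrf =>
        ⟨S.fixes_mem_of_isInj hD hi (hIi.mono hDI) (hc.mem_dom hrf), (hHc r f hrf).mono hDH⟩)
  exact ⟨⟨c, hcN⟩, isChoiceFun_permModel.2 ⟨hc, hcmem⟩⟩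

end PermSystem

end PermModel

end ZFA

open ZFA
theorem mainTheorem11 {M : Type*} [SetStr M] (hM : IsModelZFAC M)
    (A G F B : M) (hA : IsAtomSet A) (hG : IsPermGroup G A)
    (hF : IsNormalFilter F G A) (hB : IsFilterBase B F)
    (ha : ∀ x : PermModel G F, ∀ H : M, H ∈ₘ B → ∀ φ : M, φ ∈ₘ G →
      Fixes H x.1 → ∀ y : M, ActsTo φ x.1 y → Fixes H y)
    (hb : ∀ x : PermModel G F, ∃ O : PermModel G F, IsOrbit O.1 G x.1 ∧ IsCountableSet O) :
    CACTransfer (PermModel G F) ∧ PSZeroII (PermModel G F) := by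
  have : Fact (IsModelZFAC M) := ⟨hM⟩
  have S : PermSystem A G F := ⟨hA, hG, hF⟩
  exact ⟨S.cacTransfer hB ha, S.psZeroII hB ha hb⟩
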